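/- **Setting.** For $n\ge 2$ let $N=n(n-1)/2$ be the number of coordinate planes of $\mathbb R^n$. For the plane $p$ of the axes $k<\ell$ let $R(p,\theta)$ be the rotation matrix by the angle $\theta$ in that plane (entries $\cos\theta$ at $(k,k)$ and $(\ell,\ell)$, $\sin\theta$ at $(k,\ell)$, $-\sin\theta$ at $(\ell,k)$, otherwise those of the identity), and let $a_p=\frac1{\sqrt2}\frac{d}{d\theta}R(p,\theta)\big|_{\theta=0}$. Write $\langle A,B\rangle=\mathrm{Tr}(A^{\mathsf T}B)$ for the Hilbert–Schmidt inner product of real $n\times n$ matrices, $\|\cdot\|$ for its norm (and for the Euclidean norm on $\mathbb R^N$), and $\mathcal P$ for the orthogonal projection onto the skew-symmetric matrices. *Perturbation maps.* Given $X\in SO(n)$, $T\in\mathbb N$, marked times $0\le s_1<\dots<s_N<T$, planes $i_0,i_1,\dots$ and angles $\eta_0,\eta_1,\dots$, put, for $x\in\mathbb R^N$, $$F_{X,\eta}(x)=R(i_{T-1},e_{T-1}(x))\cdots R(i_0,e_0(x))\,X,$$ where $e_t(x)=\eta_t+x_l$ if $t=s_l$ and $e_t(x)=\eta_t$ if $t$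 is not a marked time. *Scaffold.* Given $X_0,Y_0\in SO(n)$, planes $(i_t)$, angles $(\eta_t)$ and a sign $\sigma\in\{1,-1\}$, define $X_{t+1}=R(i_t,\eta_t)X_t$, $Y_{t+1}=R(i_t,\eta'_t)Y_t$ with $$\eta'_t=\eta_t+\frac{\sigma}{\sqrt2}\,\langle \mathcal P(Y_tX_t^{\mathsf T}-\mathrm{Id}),a_{i_t}\rangle .$$ **Lemma (Coupling Construction).** Let $(\phi_n)$, $(\epsilon_n)$, $(\omega_n)$ be sequences with $0<\phi_n\le(2n)^{-30}$ for $n\ge2$, $\epsilon_n=\phi_n^{30}$ and $\omega_n=\epsilon_n^{30}$, and let $C$ be a constant with $0<C<\frac{\log\omega_n}{\log\epsilon_n}-6$ for all $n\ge2$. Let $n\ge2$, $\sigma\in\{1,-1\}$, let $X_0,Y_0\in SO(n)$, $T$, $(s_l)$, $(i_t)$, $(\eta_t)$ be as above, and set $f=F_{X_0,\eta}$, $g=F_{Y_0,\eta'}$. If $\sigma=-1$, suppose in addition that $\|X_0-Y_0\|\le\omega_n$. Assume that $$\|f(0)-g(0)\|\le\omega_n n^{5+C}$$ and that for $q\in\{f,g\}$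 $$\inf_{h\ne0}\frac{2\|dq_0(h)\|}{\|h\|}\ge\phi_n,\qquad \sup_{h\neq0}\frac{\|dq_0(h)\|}{\|h\|}\le N .$$ Then there are, on a common probability space, i.i.d. random variables $U_1,\dots,U_N\sim\mathrm{unif}(-\epsilon_n,\epsilon_n)$ and i.i.d. random variables $V_1,\dots,V_N\sim\mathrm{unif}(-\epsilon_n,\epsilon_n)$ such that $$\mathbb P\big[f(U_1,\dots,U_N)\ne g(V_1,\dots,V_N)\big]\le 513\,N^2\phi_n^{-1}\epsilon_n .$$ Moreover $513\,N^2\phi_n^{-1}\epsilon_n\to0$ as $n\to\infty$. -/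

import Mathlib

open MeasureTheory ProbabilityTheory Filter Topology

attribute [local instance] Matrix.frobeniusNormedAddCommGroup Matrix.frobeniusNormedSpace

namespace KacWalk

/-- Real `n × n` matrices; the norm in force is the Hilbert-Schmidt (Frobenius) norm. -/
abbrev Mat (n : ℕ) := Matrix (Fin n) (Fin n) ℝ

/-- The Hilbert-Schmidt inner product `Tr (Aᵀ B)`. -/
def hsInner {n : ℕ} (A B : Mat n) : ℝ := (A.transpose * B).trace

theorem norm_sq_eq_hsInner {n : ℕ} (A : Mat n) : ‖A‖ ^ 2 = hsInner A A := by
  rw [Matrix.frobenius_norm_def, ← Real.sqrt_eq_rpow, Real.sq_sqrt (by positivity), hsInner,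
    Matrix.trace, Finset.sum_comm]
  simp [Matrix.mul_apply, sq]

/-- The coordinate planes of `ℝⁿ`, as pairs of axes `k < l`. -/
abbrev Plane (n : ℕ) := {p : Fin n × Fin n // p.1 < p.2}

/-- The number `N = n (n - 1) / 2` of coordinate planes. -/
def numPlanes (n : ℕ) : ℕ := n * (n - 1) / 2

theorem card_plane (n : ℕ) : Fintype.card (Plane n) = numPlanes n := by
  have h := Sym2.card_subtype_not_diag (α := Fin n)
  rw [Fintype.card_fin, Nat.choose_two_right] at h
  rw [numPlanes, ← h]
  refine Fintype.card_congr (Equiv.ofBijective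
    (fun p => ⟨s(p.1.1, p.1.2), by simpa using p.2.ne⟩) ⟨?_, ?_⟩)
  · rintro ⟨⟨a, b⟩, hab⟩ ⟨⟨c, d⟩, hcd⟩ he
    simp only [Subtype.mk.injEq, Sym2.eq_iff] at he
    dsimp only at hab hcd
    rcases he with ⟨h1, h2⟩ | ⟨h1, h2⟩
    · simp [h1, h2]
    · subst h1 h2
      exact absurd hab hcd.asymm
  · rintro ⟨z, hz⟩
    induction z with
    | _ a b =>
      have hab : a ≠ b := by simpa using hz
      rcases lt_or_gt_of_ne hab with h | h
      · exact ⟨⟨(a, b), h⟩, rfl⟩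
      · exact ⟨⟨(b, a), h⟩, by simp [Sym2.eq_swap]⟩

/-- The rotation by the angle `θ` in the coordinate plane `p`. -/
noncomputable def rotation {n : ℕ} (p : Plane n) (θ : ℝ) : Mat n :=
  Matrix.of fun a b =>
    if a = b then (if a = p.1.1 ∨ a = p.1.2 then Real.cos θ else 1)
    else if a = p.1.1 ∧ b = p.1.2 then Real.sin θ
    else if a = p.1.2 ∧ b = p.1.1 then -Real.sin θ
    else 0

/-- The orthonormal basis `(1 / √2) dR_p(0)` of the Lie algebra `so(n)`. -/
noncomputable def basisVec {n : ℕ} (p : Plane n) : Mat n :=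
  (1 / Real.sqrt 2) • deriv (rotation p) 0

/-- The derivative of `rotation p` at `0` is the elementary skew-symmetric matrix of the plane. -/
theorem hasDerivAt_rotation {n : ℕ} (p : Plane n) :
    HasDerivAt (rotation p)
      (Matrix.single p.1.1 p.1.2 (1 : ℝ) - Matrix.single p.1.2 p.1.1 (1 : ℝ)) 0 := by
  have key : ∀ a b, HasDerivAt (fun θ => rotation p θ a b)
      ((Matrix.single p.1.1 p.1.2 (1 : ℝ) - Matrix.single p.1.2 p.1.1 (1 : ℝ)) a b) 0 := by
    intro a b
    obtain ⟨⟨k, l⟩, hkl⟩ := p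
    have hne : k ≠ l := ne_of_lt hkl
    have hs := Real.hasDerivAt_sin 0
    have hc := Real.hasDerivAt_cos 0
    simp only [Real.cos_zero, Real.sin_zero, neg_zero] at hs hc
    simp only [rotation, Matrix.of_apply, Matrix.sub_apply, Matrix.single_apply]
    by_cases hab : a = b
    · subst hab
      have h1 : ¬ (k = a ∧ l = a) := fun h => hne (h.1.trans h.2.symm)
      have h2 : ¬ (l = a ∧ k = a) := fun h => hne (h.2.trans h.1.symm)
      simp only [if_true, h1, h2, if_false, sub_zero]
      by_cases ha : a = k ∨ a = l
      · simpa only [ha, if_true] using hc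
      · simpa only [ha, if_false] using hasDerivAt_const (0 : ℝ) (1 : ℝ)
    · simp only [hab, if_false]
      by_cases h1 : a = k ∧ b = l
      · obtain ⟨rfl, rfl⟩ := h1
        simpa [hab, Ne.symm hab] using hs
      · by_cases h2 : a = l ∧ b = k
        · obtain ⟨rfl, rfl⟩ := h2
          have hn : HasDerivAt (fun θ => -Real.sin θ) (-1) 0 := hs.neg
          simpa [hab, Ne.symm hab] using hn
        · have h1' : ¬ (k = a ∧ l = b) := fun h => h1 ⟨h.1.symm, h.2.symm⟩
          have h2' : ¬ (l = a ∧ k = b) := fun h => h2 ⟨h.1.symm, h.2.symm⟩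
          simpa only [h1, h2, h1', h2', if_false, sub_zero] using hasDerivAt_const (0 : ℝ) (0 : ℝ)
  exact hasDerivAt_pi.2 fun a => hasDerivAt_pi.2 fun b => key a b

/-- The orthogonal projection onto the skew-symmetric matrices `so(n)`. -/
noncomputable def skewPart {n : ℕ} (A : Mat n) : Mat n := (1 / 2 : ℝ) • (A - A.transpose)

theorem skewPart_skew {n : ℕ} (A : Mat n) : (skewPart A).transpose = -skewPart A := by
  ext a b
  simp [skewPart]
  ring

/-- `skewPart A` is the skew-symmetric matrix nearest to `A` in Hilbert-Schmidt norm. -/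
theorem norm_sub_skewPart_le {n : ℕ} (A B : Mat n) (hB : B.transpose = -B) :
    ‖A - skewPart A‖ ≤ ‖A - B‖ := by
  have hd : ∀ M : Mat n, ‖M‖ ^ 2 = ∑ a, ∑ b, (M a b) ^ 2 := by
    intro M
    rw [norm_sq_eq_hsInner, hsInner, Matrix.trace, Finset.sum_comm]
    simp [Matrix.mul_apply, sq]
  have hs : ∀ a b, B b a = -B a b := fun a b => by
    have := congrFun (congrFun hB a) b
    simpa using this
  refine le_of_sq_le_sq ?_ (norm_nonneg _)
  rw [hd, hd]
  have h2 : ∑ a, ∑ b, ((A - B) a b) ^ 2 = ∑ a, ∑ b, ((A - B) b a) ^ 2 := Finset.sum_comm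
  have h3 : ∑ a, ∑ b, ((A - skewPart A) a b) ^ 2
      ≤ ∑ a, ∑ b, ((1 / 2 : ℝ) * ((A - B) a b) ^ 2 + (1 / 2) * ((A - B) b a) ^ 2) := by
    refine Finset.sum_le_sum fun a _ => Finset.sum_le_sum fun b _ => ?_
    simp only [skewPart, Matrix.sub_apply, Matrix.smul_apply, Matrix.transpose_apply, smul_eq_mul,
      hs a b]
    nlinarith [sq_nonneg (A a b - A b a - 2 * B a b)]
  simp only [Finset.sum_add_distrib, ← Finset.mul_sum] at h3
  linarith

/-- The path of Kac's walk with update planes `i` and update angles `θ`, started at `X`: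
`path i θ X t = R(i_{t-1}, θ_{t-1}) ⋯ R(i_0, θ_0) X`. -/
noncomputable def path {n : ℕ} (i : ℕ → Plane n) (θ : ℕ → ℝ) (X : Mat n) : ℕ → Mat n
  | 0 => X
  | t + 1 => rotation (i t) (θ t) * path i θ X t

/-- The increment `(1 / √2) ⟨h, a_p⟩` with `h` the projection of `Y Xᵀ - Id` onto `so(n)`. -/
noncomputable def angleShift {n : ℕ} (p : Plane n) (X Y : Mat n) : ℝ :=
  (1 / Real.sqrt 2) * hsInner (skewPart (Y * X.transpose - 1)) (basisVec p)

/-- The second scaffold path: driven by the same planes as `path i η X₀`, its angle at time `t` is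
`η t + σ * angleShift`. -/
noncomputable def scaffold {n : ℕ} (σ : ℝ) (i : ℕ → Plane n) (η : ℕ → ℝ) (X₀ Y₀ : Mat n) :
    ℕ → Mat n
  | 0 => Y₀
  | t + 1 => rotation (i t)
      (η t + σ * angleShift (i t) (path i η X₀ t) (scaffold σ i η X₀ Y₀ t)) *
        scaffold σ i η X₀ Y₀ t

/-- The angles of the second scaffold path. -/
noncomputable def scaffoldAngle {n : ℕ} (σ : ℝ) (i : ℕ → Plane n) (η : ℕ → ℝ) (X₀ Y₀ : Mat n)
    (t : ℕ) : ℝ :=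
  η t + σ * angleShift (i t) (path i η X₀ t) (scaffold σ i η X₀ Y₀ t)

theorem path_scaffoldAngle {n : ℕ} (σ : ℝ) (i : ℕ → Plane n) (η : ℕ → ℝ) (X₀ Y₀ : Mat n)
    (t : ℕ) : path i (scaffoldAngle σ i η X₀ Y₀) Y₀ t = scaffold σ i η X₀ Y₀ t := by
  induction t with
  | zero => rfl
  | succ t ih => simp only [path, scaffold, ih, scaffoldAngle]

/-- The perturbation map `x ↦ ∏_{t = T-1}^{0} R(i_t, e_t(x)) X`, where `e_t(x) = η_t + x_l` if `t` is
the marked time `s_l`, and `e_t(x) = η_t` if `t` is not marked. -/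
noncomputable def inducedMap {n : ℕ} (X : Mat n) (T : ℕ) (s : Fin (numPlanes n) → ℕ)
    (i : ℕ → Plane n) (η : ℕ → ℝ) (x : EuclideanSpace ℝ (Fin (numPlanes n))) : Mat n :=
  path i (fun t => η t + ∑ l, if s l = t then x l else 0) X T

end KacWalk

/-! Perturbing the angles of a path multiplies its endpoint on the right by a product of small
rotations, each conjugated by the unperturbed path at its time (`path_add_eq`). Factors at unmarked
times are trivial, so every estimate depends on N and never on T. In particular the second
differences of f are O(N²).

The scaffold moves the distance of the two unperturbed paths monotonically: down for σ = -1, up for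
σ = 1. Hence closeness at one end, time 0 or time T respectively, controls all intermediate times by
one number w (`norm_sub_scaffold_le`). Comparing the conjugating frames, g - f is then of size O(w)
near 0 and has Lipschitz constant O(N w) there (`norm_inducedMap_diff_sub_le`).

Since df₀ is nondegenerate and has as many coordinates as there are planes, the skew-symmetric part
of A f(0)ᵀ, followed by an inverse matrix, is a linear chart Λ of the orthogonal group near f(0) in
which f has derivative the identity (`exists_chart`). With F = Λ ∘ f and G = Λ ∘ g, the contraction
principle solves F(y + e(y)) = G(y), with e tiny both in sup norm and in Lipschitz norm
(`exists_solution_near`). Injectivity of the chart turns this into f(y + e(y)) = g(y).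

If V is uniform on the cube of half-width ε, then V + e(V) is almost uniform, because id + e nearly
preserves the cube and its volume. So the relation U = V + e(V) can be realised by a coupling of
uniform vectors outside an event of probability at most N(k + r/ε), where r bounds e and k is its
Lipschitz constant (`exists_uniform_coupling`). The parameters are separated by such large powers of
φ that all factors polynomial in n are absorbed. -/

namespace KacWalk

open Matrix

/-! ### Algebra and traces of plane rotations. -/

section Rotation

variable {n : ℕ}

/-- The infinitesimal rotation in the plane `p`. -/
def planeGen (p : Plane n) : Mat n := single p.1.1 p.1.2 1 - single p.1.2 p.1.1 1

/-- The orthogonal projection onto the plane `p`. -/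
def planeProj (p : Plane n) : Mat n := single p.1.1 p.1.1 1 + single p.1.2 p.1.2 1

theorem planeGen_mul_self (p : Plane n) : planeGen p * planeGen p = -planeProj p := by
  have h : p.1.1 ≠ p.1.2 := p.2.ne
  simp [planeGen, planeProj, mul_sub, sub_mul, h, h.symm]
  abel

theorem planeGen_mul_planeProj (p : Plane n) : planeGen p * planeProj p = planeGen p := by
  have h : p.1.1 ≠ p.1.2 := p.2.ne
  simp [planeGen, planeProj, mul_add, sub_mul, h, h.symm]
  abel

theorem planeProj_mul_planeGen (p : Plane n) : planeProj p * planeGen p = planeGen p := by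
  have h : p.1.1 ≠ p.1.2 := p.2.ne
  simp [planeGen, planeProj, mul_sub, add_mul, h, h.symm]

theorem planeProj_mul_self (p : Plane n) : planeProj p * planeProj p = planeProj p := by
  have h : p.1.1 ≠ p.1.2 := p.2.ne
  simp [planeProj, mul_add, add_mul, h, h.symm]

/-- The generator and the projection of a plane multiply like i and 1, so this form reduces the
group law to the addition formulas. -/
theorem rotation_eq (p : Plane n) (θ : ℝ) :
    rotation p θ = 1 + Real.sin θ • planeGen p + (Real.cos θ - 1) • planeProj p := by
  obtain ⟨⟨k, l⟩, hkl⟩ := p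
  have hne : k ≠ l := ne_of_lt hkl
  ext a b
  simp only [rotation, planeGen, planeProj, of_apply, Matrix.add_apply, Matrix.sub_apply,
    Matrix.smul_apply, single_apply, one_apply, smul_eq_mul]
  grind

theorem rotation_zero (p : Plane n) : rotation p 0 = 1 := by simp [rotation_eq]

theorem rotation_add (p : Plane n) (s t : ℝ) :
    rotation p (s + t) = rotation p s * rotation p t := by
  simp only [rotation_eq, mul_add, add_mul, smul_mul_assoc, mul_smul_comm, mul_one, one_mul,
    planeGen_mul_self, planeGen_mul_planeProj, planeProj_mul_planeGen, planeProj_mul_self,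
    Real.sin_add, Real.cos_add]
  module

theorem rotation_transpose (p : Plane n) (θ : ℝ) : (rotation p θ)ᵀ = rotation p (-θ) := by
  simp only [rotation_eq, planeGen, planeProj, transpose_add, transpose_sub, transpose_smul,
    transpose_single, transpose_one, Real.sin_neg, Real.cos_neg]
  module

theorem rotation_orthogonal (p : Plane n) (θ : ℝ) : (rotation p θ)ᵀ * rotation p θ = 1 := by
  rw [rotation_transpose, ← rotation_add, neg_add_cancel, rotation_zero]

theorem trace_rotation_mul (p : Plane n) (θ : ℝ) (W : Mat n) :
    (rotation p θ * W).trace = W.trace + Real.sin θ * (W p.1.2 p.1.1 - W p.1.1 p.1.2) +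
      (Real.cos θ - 1) * (W p.1.1 p.1.1 + W p.1.2 p.1.2) := by
  simp [rotation_eq, planeGen, planeProj, add_mul, sub_mul, trace_single_mul]
  ring

theorem trace_rotation (p : Plane n) (θ : ℝ) :
    (rotation p θ).trace = n + 2 * (Real.cos θ - 1) := by
  have h := trace_rotation_mul p θ 1
  have hne : p.1.1 ≠ p.1.2 := p.2.ne
  rw [mul_one] at h
  rw [h]
  simp [one_apply, hne, hne.symm]
  ring

end Rotation

/-! ### Hilbert–Schmidt norm estimates. -/

section Norm

variable {n : ℕ}

theorem mul_transpose_of_orthogonal {Q : Mat n} (hQ : Qᵀ * Q = 1) : Q * Qᵀ = 1 :=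
  mul_eq_one_comm.1 hQ

theorem orthogonal_mul {Q R : Mat n} (hQ : Qᵀ * Q = 1) (hR : Rᵀ * R = 1) :
    (Q * R)ᵀ * (Q * R) = 1 := by
  rw [transpose_mul, Matrix.mul_assoc, ← Matrix.mul_assoc _ Q, hQ, Matrix.one_mul, hR]

theorem orthogonal_transpose {Q : Mat n} (hQ : Qᵀ * Q = 1) : Qᵀᵀ * Qᵀ = 1 := by
  rw [transpose_transpose, mul_transpose_of_orthogonal hQ]

theorem norm_orthogonal_mul {Q : Mat n} (hQ : Qᵀ * Q = 1) (A : Mat n) : ‖Q * A‖ = ‖A‖ := by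
  have : ‖Q * A‖ ^ 2 = ‖A‖ ^ 2 := by
    rw [norm_sq_eq_hsInner, norm_sq_eq_hsInner, hsInner, hsInner, transpose_mul,
      Matrix.mul_assoc, ← Matrix.mul_assoc _ Q, hQ, Matrix.one_mul]
  exact (sq_eq_sq₀ (norm_nonneg _) (norm_nonneg _)).1 this

theorem norm_mul_orthogonal {Q : Mat n} (hQ : Qᵀ * Q = 1) (A : Mat n) : ‖A * Q‖ = ‖A‖ := by
  rw [← frobenius_norm_transpose, transpose_mul, norm_orthogonal_mul (orthogonal_transpose hQ),
    frobenius_norm_transpose]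

/-- The squared distance is an affine function of one trace, so monotonicity of distances along the
scaffold becomes monotonicity of a trace. -/
theorem norm_orthogonal_sub_sq {X Y : Mat n} (hX : Xᵀ * X = 1) (hY : Yᵀ * Y = 1) :
    ‖X - Y‖ ^ 2 = 2 * n - 2 * (Y * Xᵀ).trace := by
  have h1 : (Xᵀ * Y).trace = (Y * Xᵀ).trace := trace_mul_comm _ _
  have h2 : (Yᵀ * X).trace = (Y * Xᵀ).trace := by
    rw [← trace_transpose, transpose_mul, transpose_transpose, h1]
  rw [norm_sq_eq_hsInner, hsInner, transpose_sub, Matrix.sub_mul, Matrix.mul_sub, Matrix.mul_sub,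
    hX, hY]
  simp only [trace_sub, trace_one, Fintype.card_fin, h1, h2]
  ring

theorem abs_apply_le_norm (A : Mat n) (a b : Fin n) : |A a b| ≤ ‖A‖ := by
  have hd : ‖A‖ ^ 2 = ∑ a, ∑ b, (A a b) ^ 2 := by
    rw [norm_sq_eq_hsInner, hsInner, trace, Finset.sum_comm]
    simp [mul_apply, sq]
  refine abs_le_of_sq_le_sq ?_ (norm_nonneg _)
  rw [hd]
  calc (A a b) ^ 2 ≤ ∑ b, (A a b) ^ 2 :=
        Finset.single_le_sum (f := fun b => (A a b) ^ 2) (fun _ _ => sq_nonneg _) (Finset.mem_univ b)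
    _ ≤ _ := Finset.single_le_sum (f := fun a => ∑ b, (A a b) ^ 2)
          (fun _ _ => Finset.sum_nonneg fun _ _ => sq_nonneg _) (Finset.mem_univ a)

theorem norm_le_of_abs_apply_le {A : Mat n} {c : ℝ} (hc : 0 ≤ c) (h : ∀ a b, |A a b| ≤ c) :
    ‖A‖ ≤ n * c := by
  have hd : ‖A‖ ^ 2 = ∑ a, ∑ b, (A a b) ^ 2 := by
    rw [norm_sq_eq_hsInner, hsInner, trace, Finset.sum_comm]
    simp [mul_apply, sq]
  refine le_of_sq_le_sq ?_ (by positivity)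
  rw [hd]
  calc ∑ a, ∑ b, (A a b) ^ 2 ≤ ∑ _a : Fin n, ∑ _b : Fin n, c ^ 2 :=
        Finset.sum_le_sum fun a _ => Finset.sum_le_sum fun b _ => sq_le_sq' (abs_le.1 (h a b)).1
          (abs_le.1 (h a b)).2
    _ = (n * c) ^ 2 := by simp; ring

theorem abs_apply_le_one {Q : Mat n} (hQ : Qᵀ * Q = 1) (a b : Fin n) : |Q a b| ≤ 1 := by
  have h : ∑ c, Q c b ^ 2 = 1 := by
    have := congrFun (congrFun hQ b) b
    simpa [mul_apply, sq] using this
  have h2 : Q a b ^ 2 ≤ 1 := h ▸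
    Finset.single_le_sum (f := fun c => Q c b ^ 2) (fun _ _ => sq_nonneg _) (Finset.mem_univ a)
  exact (sq_le_one_iff_abs_le_one _).1 h2

theorem norm_rotation_sub_one_le (p : Plane n) (θ : ℝ) : ‖rotation p θ - 1‖ ≤ 2 * |θ| := by
  refine le_of_sq_le_sq ?_ (by positivity)
  rw [norm_orthogonal_sub_sq (rotation_orthogonal p θ) (by simp), Matrix.one_mul,
    trace_transpose, trace_rotation, mul_pow, sq_abs]
  nlinarith [Real.one_sub_sq_div_two_le_cos (x := θ), sq_nonneg θ]

theorem norm_rotation_sub_le (p : Plane n) (s t : ℝ) :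
    ‖rotation p s - rotation p t‖ ≤ 2 * |s - t| := by
  have : rotation p s - rotation p t = rotation p t * (rotation p (s - t) - 1) := by
    rw [Matrix.mul_sub, ← rotation_add, mul_one, add_sub_cancel]
  rw [this, norm_orthogonal_mul (rotation_orthogonal p t)]
  exact norm_rotation_sub_one_le p _

/-- By the group law the second difference factors as R(c) (R(d) - 1) (R(e) - 1). -/
theorem norm_rotation_second_difference_le (p : Plane n) (c d e : ℝ) :
    ‖rotation p (c + d + e) - rotation p (c + d) - rotation p (c + e) + rotation p c‖ ≤
      4 * |d| * |e| := by
  have : rotation p (c + d + e) - rotation p (c + d) - rotation p (c + e) + rotation p c =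
      rotation p c * ((rotation p d - 1) * (rotation p e - 1)) := by
    simp only [rotation_add]
    noncomm_ring
  rw [this, norm_orthogonal_mul (rotation_orthogonal p c)]
  refine (frobenius_norm_mul _ _).trans ?_
  calc _ ≤ (2 * |d|) * (2 * |e|) := by
        gcongr <;> exact norm_rotation_sub_one_le p _
    _ = _ := by ring

end Norm

/-! ### Monotonicity of the scaffold distance. -/

section Scaffold

variable {n : ℕ}

theorem path_orthogonal (i : ℕ → Plane n) (θ : ℕ → ℝ) {X : Mat n} (hX : Xᵀ * X = 1) (t : ℕ) :
    (path i θ X t)ᵀ * path i θ X t = 1 := by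
  induction t with
  | zero => exact hX
  | succ t ih => exact orthogonal_mul (rotation_orthogonal _ _) ih

theorem scaffold_orthogonal (σ : ℝ) (i : ℕ → Plane n) (η : ℕ → ℝ) (X₀ : Mat n) {Y₀ : Mat n}
    (hY : Y₀ᵀ * Y₀ = 1) (t : ℕ) :
    (scaffold σ i η X₀ Y₀ t)ᵀ * scaffold σ i η X₀ Y₀ t = 1 := by
  rw [← path_scaffoldAngle]
  exact path_orthogonal _ _ hY _

/-- The two factors 1/√2, one from the shift and one from the basis vector, combine to 1/2; the
identity matrix, being symmetric, drops out. -/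
theorem angleShift_eq (p : Plane n) (X Y : Mat n) :
    angleShift p X Y = ((Y * Xᵀ) p.1.1 p.1.2 - (Y * Xᵀ) p.1.2 p.1.1) / 2 := by
  have hs : (√2)⁻¹ * (√2)⁻¹ = (1 / 2 : ℝ) := by
    rw [← mul_inv, Real.mul_self_sqrt (by norm_num)]; norm_num
  have h1 : ∀ A : Mat n, hsInner A (single p.1.1 p.1.2 1 - single p.1.2 p.1.1 1) =
      A p.1.1 p.1.2 - A p.1.2 p.1.1 := by
    intro A
    simp [hsInner, Matrix.mul_sub, trace_mul_single]
  have h2 : ∀ (A B : Mat n) (c : ℝ), hsInner A (c • B) = c * hsInner A B := by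
    intro A B c
    simp [hsInner]
  have h3 : basisVec p = (1 / √2) • (single p.1.1 p.1.2 (1 : ℝ) - single p.1.2 p.1.1 (1 : ℝ)) :=
    congrArg _ (hasDerivAt_rotation p).deriv
  rw [angleShift, h3, h2, h1, one_div, ← mul_assoc, hs]
  generalize Y * Xᵀ = W
  simp [skewPart]
  ring

/-- Both sides are compared with u²/2, the right one through a cubic lower bound for the sine. This
makes the first-order gain of a scaffold step beat its second-order loss. -/
theorem one_sub_cos_le_mul_sin {u : ℝ} (hu : |u| ≤ 1) : 1 - Real.cos u ≤ u * Real.sin u := by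
  have h1 := Real.one_sub_sq_div_two_le_cos (x := u)
  have key : ∀ v : ℝ, 0 ≤ v → v ≤ 1 → v ^ 2 / 2 ≤ v * Real.sin v := by
    intro v h0 h1
    rcases h0.eq_or_lt with rfl | h0
    · simp
    · have := Real.sin_gt_sub_cube h0
      nlinarith [mul_pos h0 h0, mul_pos (mul_pos h0 h0) h0]
  have h2 := key |u| (abs_nonneg u) hu
  rw [sq_abs] at h2
  have h3 : |u| * Real.sin |u| = u * Real.sin u := by
    rcases abs_cases u with ⟨h, _⟩ | ⟨h, _⟩ <;> rw [h]
    rw [Real.sin_neg]; ring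
  linarith

/-- By cyclicity of the trace the common angle η cancels and only the shift is left. -/
theorem trace_scaffold_succ (σ : ℝ) (i : ℕ → Plane n) (η : ℕ → ℝ) (X₀ Y₀ : Mat n) (t : ℕ) :
    (scaffold σ i η X₀ Y₀ (t + 1) * (path i η X₀ (t + 1))ᵀ).trace =
      (rotation (i t) (σ * angleShift (i t) (path i η X₀ t) (scaffold σ i η X₀ Y₀ t)) *
        (scaffold σ i η X₀ Y₀ t * (path i η X₀ t)ᵀ)).trace := by
  rw [scaffold, path, transpose_mul, Matrix.mul_assoc, ← Matrix.mul_assoc (scaffold _ _ _ _ _ _),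
    ← Matrix.mul_assoc, trace_mul_comm, ← Matrix.mul_assoc, rotation_transpose,
    ← Matrix.mul_assoc, ← rotation_add, neg_add_cancel_left, Matrix.mul_assoc]

/-- The distance of the two scaffold paths does not increase if `σ = -1`. -/
theorem norm_sub_scaffold_succ_le (i : ℕ → Plane n) (η : ℕ → ℝ) {X₀ Y₀ : Mat n}
    (hX : X₀ᵀ * X₀ = 1) (hY : Y₀ᵀ * Y₀ = 1) (t : ℕ) :
    ‖path i η X₀ (t + 1) - scaffold (-1) i η X₀ Y₀ (t + 1)‖ ≤
      ‖path i η X₀ t - scaffold (-1) i η X₀ Y₀ t‖ := by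
  have oX := path_orthogonal i η hX
  have oY := scaffold_orthogonal (-1) i η X₀ hY
  refine le_of_sq_le_sq ?_ (norm_nonneg _)
  rw [norm_orthogonal_sub_sq (oX _) (oY _), norm_orthogonal_sub_sq (oX _) (oY _),
    trace_scaffold_succ, trace_rotation_mul, angleShift_eq]
  have oW := orthogonal_mul (oY t) (orthogonal_transpose (oX t))
  set W := scaffold (-1) i η X₀ Y₀ t * (path i η X₀ t)ᵀ
  have hW := fun a b => abs_le.1 (abs_apply_le_one oW a b)
  set u := (W (i t).1.1 (i t).1.2 - W (i t).1.2 (i t).1.1) / 2 with hu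
  have hu1 : |u| ≤ 1 := by
    have h1 := hW (i t).1.1 (i t).1.2
    have h2 := hW (i t).1.2 (i t).1.1
    exact abs_le.2 ⟨by linarith, by linarith⟩
  have h3 := one_sub_cos_le_mul_sin hu1
  have h4 : W (i t).1.2 (i t).1.1 - W (i t).1.1 (i t).1.2 = -(2 * u) := by rw [hu]; ring
  rw [h4, neg_one_mul, Real.sin_neg, Real.cos_neg]
  have h5 := hW (i t).1.1 (i t).1.1
  have h6 := hW (i t).1.2 (i t).1.2
  -- The trace grows by 2 u sin u - (1 - cos u)(W_kk + W_ll), where the diagonal sum is at most 2.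
  nlinarith [Real.cos_le_one u]

/-- The distance of the two scaffold paths does not decrease if `σ = 1`. -/
theorem norm_sub_scaffold_le_succ (i : ℕ → Plane n) (η : ℕ → ℝ) {X₀ Y₀ : Mat n}
    (hX : X₀ᵀ * X₀ = 1) (hY : Y₀ᵀ * Y₀ = 1) (t : ℕ) :
    ‖path i η X₀ t - scaffold 1 i η X₀ Y₀ t‖ ≤
      ‖path i η X₀ (t + 1) - scaffold 1 i η X₀ Y₀ (t + 1)‖ := by
  have oX := path_orthogonal i η hX
  have oY := scaffold_orthogonal 1 i η X₀ hY
  refine le_of_sq_le_sq ?_ (norm_nonneg _)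
  rw [norm_orthogonal_sub_sq (oX _) (oY _), norm_orthogonal_sub_sq (oX _) (oY _),
    trace_scaffold_succ, trace_rotation_mul, angleShift_eq]
  have oW := orthogonal_mul (oY t) (orthogonal_transpose (oX t))
  set W := scaffold 1 i η X₀ Y₀ t * (path i η X₀ t)ᵀ
  have hW := fun a b => abs_le.1 (abs_apply_le_one oW a b)
  set u := (W (i t).1.1 (i t).1.2 - W (i t).1.2 (i t).1.1) / 2 with hu
  have hu1 : |u| ≤ 1 := by
    have h1 := hW (i t).1.1 (i t).1.2
    have h2 := hW (i t).1.2 (i t).1.1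
    exact abs_le.2 ⟨by linarith, by linarith⟩
  have h3 := one_sub_cos_le_mul_sin hu1
  have h4 : W (i t).1.2 (i t).1.1 - W (i t).1.1 (i t).1.2 = -(2 * u) := by rw [hu]; ring
  rw [h4, one_mul]
  have h5 := hW (i t).1.1 (i t).1.1
  have h6 := hW (i t).1.2 (i t).1.2
  -- Now the trace changes by -2 u sin u - (1 - cos u)(W_kk + W_ll), where the diagonal sum is at
  -- least -2.
  nlinarith [Real.cos_le_one u]

/-- The two scaffold paths stay close up to time `T` if they are close at the time `T` and, in the
contracting case `σ = -1`, at the time `0`. -/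
theorem norm_sub_scaffold_le {σ : ℝ} (hσ : σ = 1 ∨ σ = -1) (i : ℕ → Plane n) (η : ℕ → ℝ)
    {X₀ Y₀ : Mat n} (hX : X₀ᵀ * X₀ = 1) (hY : Y₀ᵀ * Y₀ = 1) {T : ℕ} {w : ℝ}
    (h0 : σ = -1 → ‖X₀ - Y₀‖ ≤ w) (hT : ‖path i η X₀ T - scaffold σ i η X₀ Y₀ T‖ ≤ w)
    {t : ℕ} (ht : t ≤ T) : ‖path i η X₀ t - scaffold σ i η X₀ Y₀ t‖ ≤ w := by
  rcases hσ with rfl | rfl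
  · exact (monotone_nat_of_le_succ (norm_sub_scaffold_le_succ i η hX hY) ht).trans hT
  · have h := antitone_nat_of_succ_le
      (f := fun t => ‖path i η X₀ t - scaffold (-1) i η X₀ Y₀ t‖)
      (norm_sub_scaffold_succ_le i η hX hY) (Nat.zero_le t)
    exact h.trans (h0 rfl)

end Scaffold

/-! ### Perturbations as products of conjugated rotations. -/

section FrameProd

variable {n : ℕ}

/-- The product of the rotations by the angles `c t` in the planes `i t` seen in the frames `Q t`. -/
noncomputable def frameProd (i : ℕ → Plane n) (Q : ℕ → Mat n) (c : ℕ → ℝ) : ℕ → Mat n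
  | 0 => 1
  | t + 1 => (Q t)ᵀ * rotation (i t) (c t) * Q t * frameProd i Q c t

/-- Inserting Q Qᵀ = 1 with Q the unperturbed path moves each extra rotation to the right of that
path. What remains is trivial at every time with c = 0. -/
theorem path_add_eq (i : ℕ → Plane n) (η c : ℕ → ℝ) {X : Mat n} (hX : Xᵀ * X = 1) (t : ℕ) :
    path i (fun τ => η τ + c τ) X t = path i η X t * frameProd i (path i η X) c t := by
  induction t with
  | zero => simp [path, frameProd]
  | succ t ih =>
    have h := mul_transpose_of_orthogonal (path_orthogonal i η hX t)
    rw [frameProd, path, ih, path, rotation_add]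
    simp only [← Matrix.mul_assoc]
    rw [Matrix.mul_assoc (rotation _ _) _ (_)ᵀ, h, Matrix.mul_one]

variable {i : ℕ → Plane n} {Q Q' : ℕ → Mat n} {c c' d e : ℕ → ℝ}

theorem frame_orthogonal (hQ : ∀ t, (Q t)ᵀ * Q t = 1) (t : ℕ) (x : ℝ) :
    ((Q t)ᵀ * rotation (i t) x * Q t)ᵀ * ((Q t)ᵀ * rotation (i t) x * Q t) = 1 :=
  orthogonal_mul (orthogonal_mul (orthogonal_transpose (hQ t)) (rotation_orthogonal _ _)) (hQ t)

theorem frameProd_orthogonal (hQ : ∀ t, (Q t)ᵀ * Q t = 1) (t : ℕ) :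
    (frameProd i Q c t)ᵀ * frameProd i Q c t = 1 := by
  induction t with
  | zero => simp [frameProd]
  | succ t ih => exact orthogonal_mul (frame_orthogonal hQ t _) ih

theorem norm_frame_conj (hQ : ∀ t, (Q t)ᵀ * Q t = 1) (t : ℕ) (A : Mat n) :
    ‖(Q t)ᵀ * A * Q t‖ = ‖A‖ := by
  rw [norm_mul_orthogonal (hQ t), norm_orthogonal_mul (orthogonal_transpose (hQ t))]

theorem norm_frame_sub_le (hQ : ∀ t, (Q t)ᵀ * Q t = 1) (t : ℕ) (x y : ℝ) :
    ‖(Q t)ᵀ * rotation (i t) x * Q t - (Q t)ᵀ * rotation (i t) y * Q t‖ ≤ 2 * |x - y| := by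
  rw [← Matrix.sub_mul, ← Matrix.mul_sub, norm_frame_conj hQ]
  exact norm_rotation_sub_le _ _ _

theorem norm_conj_sub_conj_le {Q Q' : Mat n} (hQ : Qᵀ * Q = 1) (hQ' : Q'ᵀ * Q' = 1) (A : Mat n) :
    ‖Qᵀ * A * Q - Q'ᵀ * A * Q'‖ ≤ 2 * ‖Q - Q'‖ * ‖A‖ := by
  have h : Qᵀ * A * Q - Q'ᵀ * A * Q' = (Q - Q')ᵀ * A * Q + Q'ᵀ * (A * (Q - Q')) := by
    rw [transpose_sub]; noncomm_ring
  rw [h]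
  refine (norm_add_le _ _).trans ?_
  rw [norm_mul_orthogonal hQ, norm_orthogonal_mul (orthogonal_transpose hQ')]
  have h1 := frobenius_norm_mul (Q - Q')ᵀ A
  have h2 := frobenius_norm_mul A (Q - Q')
  rw [frobenius_norm_transpose] at h1
  linarith

theorem norm_frameProd_sub_le (hQ : ∀ t, (Q t)ᵀ * Q t = 1) (t : ℕ) :
    ‖frameProd i Q c t - frameProd i Q c' t‖ ≤ 2 * ∑ τ ∈ Finset.range t, |c τ - c' τ| := by
  induction t with
  | zero => simp [frameProd]
  | succ t ih =>
    rw [frameProd, frameProd, Finset.sum_range_succ]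
    have h : ∀ A A' B B' : Mat n, A * B - A' * B' = (A - A') * B + A' * (B - B') := by
      intros; noncomm_ring
    rw [h]
    refine (norm_add_le _ _).trans ?_
    rw [norm_mul_orthogonal (frameProd_orthogonal hQ t),
      norm_orthogonal_mul (frame_orthogonal hQ t _)]
    linarith [norm_frame_sub_le (i := i) hQ t (c t) (c' t)]

theorem norm_frameProd_second_difference_le (hQ : ∀ t, (Q t)ᵀ * Q t = 1) (t : ℕ) :
    ‖frameProd i Q (c + d + e) t - frameProd i Q (c + d) t - frameProd i Q (c + e) t
        + frameProd i Q c t‖ ≤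
      4 * (∑ τ ∈ Finset.range t, |d τ|) * ∑ τ ∈ Finset.range t, |e τ| := by
  induction t with
  | zero => simp [frameProd]
  | succ t ih =>
    simp only [frameProd, Finset.sum_range_succ]
    -- The discrete product rule for second differences: every summand carries one increment from d
    -- and one from e.
    have h : ∀ A₀ A₁ A₂ A₃ B₀ B₁ B₂ B₃ : Mat n,
        A₃ * B₃ - A₁ * B₁ - A₂ * B₂ + A₀ * B₀ =
          (A₃ - A₁ - A₂ + A₀) * B₃ + (A₁ - A₀) * (B₃ - B₁) + (A₂ - A₀) * (B₃ - B₂)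
            + A₀ * (B₃ - B₁ - B₂ + B₀) := by
      intros; noncomm_ring
    rw [h]
    refine (norm_add₄_le ..).trans ?_
    rw [norm_mul_orthogonal (frameProd_orthogonal hQ t),
      norm_orthogonal_mul (frame_orthogonal hQ t _)]
    have m1 := frobenius_norm_mul
      ((Q t)ᵀ * rotation (i t) ((c + d) t) * Q t - (Q t)ᵀ * rotation (i t) (c t) * Q t)
      (frameProd i Q (c + d + e) t - frameProd i Q (c + d) t)
    have m2 := frobenius_norm_mul
      ((Q t)ᵀ * rotation (i t) ((c + e) t) * Q t - (Q t)ᵀ * rotation (i t) (c t) * Q t)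
      (frameProd i Q (c + d + e) t - frameProd i Q (c + e) t)
    have a1 := norm_frame_sub_le (i := i) hQ t ((c + d) t) (c t)
    have a2 := norm_frame_sub_le (i := i) hQ t ((c + e) t) (c t)
    have b1 := norm_frameProd_sub_le (i := i) (c := c + d + e) (c' := c + d) hQ t
    have b2 := norm_frameProd_sub_le (i := i) (c := c + d + e) (c' := c + e) hQ t
    have k : ∀ τ, c τ + d τ + e τ - (c τ + e τ) = d τ := fun τ => by ring
    simp only [Pi.add_apply, add_sub_cancel_left, k] at m1 m2 a1 a2 b1 b2 ⊢
    have s : ‖(Q t)ᵀ * rotation (i t) (c t + d t + e t) * Q t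
        - (Q t)ᵀ * rotation (i t) (c t + d t) * Q t - (Q t)ᵀ * rotation (i t) (c t + e t) * Q t
        + (Q t)ᵀ * rotation (i t) (c t) * Q t‖ ≤ 4 * |d t| * |e t| := by
      rw [← Matrix.sub_mul, ← Matrix.mul_sub, ← Matrix.sub_mul, ← Matrix.mul_sub,
        ← Matrix.add_mul, ← Matrix.mul_add, norm_frame_conj hQ]
      exact norm_rotation_second_difference_le _ _ _ _
    have p1 := m1.trans (mul_le_mul a1 b1 (norm_nonneg _) (by positivity))
    have p2 := m2.trans (mul_le_mul a2 b2 (norm_nonneg _) (by positivity))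
    refine (add_le_add (add_le_add (add_le_add s p1) p2) ih).trans (le_of_eq ?_)
    ring

variable {w : ℝ}

theorem norm_frame_diff_sub_le (hQ : ∀ t, (Q t)ᵀ * Q t = 1) (hQ' : ∀ t, (Q' t)ᵀ * Q' t = 1)
    {t : ℕ} (hw : ‖Q t - Q' t‖ ≤ w) (x y : ℝ) :
    ‖((Q t)ᵀ * rotation (i t) x * Q t - (Q' t)ᵀ * rotation (i t) x * Q' t)
      - ((Q t)ᵀ * rotation (i t) y * Q t - (Q' t)ᵀ * rotation (i t) y * Q' t)‖ ≤
      4 * w * |x - y| := by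
  rw [sub_sub_sub_comm, ← Matrix.sub_mul, ← Matrix.mul_sub, ← Matrix.sub_mul, ← Matrix.mul_sub]
  refine (norm_conj_sub_conj_le (hQ t) (hQ' t) _).trans ?_
  calc _ ≤ 2 * w * (2 * |x - y|) := by
        gcongr
        · exact (mul_nonneg zero_le_two ((norm_nonneg _).trans hw))
        · exact norm_rotation_sub_le _ _ _
    _ = _ := by ring

theorem norm_frame_diff_le (hQ : ∀ t, (Q t)ᵀ * Q t = 1) (hQ' : ∀ t, (Q' t)ᵀ * Q' t = 1)
    {t : ℕ} (hw : ‖Q t - Q' t‖ ≤ w) (x : ℝ) :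
    ‖(Q t)ᵀ * rotation (i t) x * Q t - (Q' t)ᵀ * rotation (i t) x * Q' t‖ ≤ 4 * w * |x| := by
  have h := norm_frame_diff_sub_le (i := i) hQ hQ' hw x 0
  simpa [rotation_zero, hQ, hQ'] using h

theorem norm_frameProd_diff_le (hQ : ∀ t, (Q t)ᵀ * Q t = 1) (hQ' : ∀ t, (Q' t)ᵀ * Q' t = 1)
    {t : ℕ} (hw : ∀ τ < t, ‖Q τ - Q' τ‖ ≤ w) :
    ‖frameProd i Q c t - frameProd i Q' c t‖ ≤ 4 * w * ∑ τ ∈ Finset.range t, |c τ| := by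
  induction t with
  | zero => simp [frameProd]
  | succ t ih =>
    rw [frameProd, frameProd, Finset.sum_range_succ]
    have h : ∀ A A' B B' : Mat n, A * B - A' * B' = (A - A') * B + A' * (B - B') := by
      intros; noncomm_ring
    rw [h]
    refine (norm_add_le _ _).trans ?_
    rw [norm_mul_orthogonal (frameProd_orthogonal hQ t),
      norm_orthogonal_mul (frame_orthogonal hQ' t _)]
    have h1 := ih fun τ hτ => hw τ (hτ.trans (Nat.lt_succ_self t))
    have h2 := norm_frame_diff_le (i := i) hQ hQ' (hw t (Nat.lt_succ_self t)) (c t)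
    linarith

/-- A mixed difference, once in the frames and once in the angles, so the bound contains both w and
the change of the angles. The last factor pays for the cross terms of the product rule. This is what
bounds the Lipschitz constant, and not only the size, of the difference of two perturbation maps. -/
theorem norm_frameProd_diff_sub_le (hQ : ∀ t, (Q t)ᵀ * Q t = 1)
    (hQ' : ∀ t, (Q' t)ᵀ * Q' t = 1) (hw0 : 0 ≤ w) {t : ℕ} (hw : ∀ τ < t, ‖Q τ - Q' τ‖ ≤ w) :
    ‖(frameProd i Q c t - frameProd i Q' c t) - (frameProd i Q c' t - frameProd i Q' c' t)‖ ≤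
      4 * w * (∑ τ ∈ Finset.range t, |c τ - c' τ|) *
        (1 + 2 * ∑ τ ∈ Finset.range t, (|c τ| + |c' τ|)) := by
  induction t with
  | zero => simp [frameProd]
  | succ t ih =>
    simp only [frameProd, Finset.sum_range_succ]
    have h : ∀ A A' B B' D D' E E' : Mat n, A * E - A' * E' - (B * D - B' * D') =
        (A - A' - (B - B')) * E + (B - B') * (E - D) + (A' - B') * (E - E')
          + B' * (E - E' - (D - D')) := by
      intros; noncomm_ring
    rw [h]
    refine (norm_add₄_le ..).trans ?_
    rw [norm_mul_orthogonal (frameProd_orthogonal hQ t),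
      norm_orthogonal_mul (frame_orthogonal hQ' t _)]
    have hw' : ∀ τ < t, ‖Q τ - Q' τ‖ ≤ w := fun τ hτ => hw τ (hτ.trans (Nat.lt_succ_self t))
    have hwt := hw t (Nat.lt_succ_self t)
    have h0 := ih hw'
    have h1 := norm_frame_diff_sub_le (i := i) hQ hQ' hwt (c t) (c' t)
    have h2 := (frobenius_norm_mul _ _).trans (mul_le_mul
      (norm_frame_diff_le (i := i) hQ hQ' hwt (c' t))
      (norm_frameProd_sub_le (i := i) (c := c) (c' := c') hQ t) (norm_nonneg _) (by positivity))
    have h3 := (frobenius_norm_mul _ _).trans (mul_le_mul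
      (norm_frame_sub_le (i := i) hQ' t (c t) (c' t))
      (norm_frameProd_diff_le (i := i) (c := c) hQ hQ' hw') (norm_nonneg _) (by positivity))
    refine (add_le_add (add_le_add (add_le_add h1 h2) h3) h0).trans ?_
    have hA : ∑ τ ∈ Finset.range t, |c τ| ≤ ∑ τ ∈ Finset.range t, (|c τ| + |c' τ|) :=
      Finset.sum_le_sum fun τ _ => le_add_of_nonneg_right (abs_nonneg _)
    set S := ∑ τ ∈ Finset.range t, |c τ - c' τ|
    set A := ∑ τ ∈ Finset.range t, (|c τ| + |c' τ|)
    set A' := ∑ τ ∈ Finset.range t, |c τ|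
    have hS : 0 ≤ S := Finset.sum_nonneg fun _ _ => abs_nonneg _
    have e1 : 0 ≤ w * (|c t - c' t| * (A - A')) :=
      mul_nonneg hw0 (mul_nonneg (abs_nonneg _) (sub_nonneg.2 hA))
    have e2 : 0 ≤ w * (S * |c t|) := by positivity
    have e3 : 0 ≤ w * (|c t - c' t| * (|c t| + |c' t|)) := by positivity
    linarith

end FrameProd

/-! ### Orthogonal matrices and their skew-symmetric parts. -/

section ChartInjective

variable {n : ℕ}

/-- Near the identity, an orthogonal matrix is determined by its skew-symmetric part. -/
theorem eq_of_skewPart_eq {V W : Mat n} (hV : Vᵀ * V = 1) (hW : Wᵀ * W = 1)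
    (hVW : skewPart V = skewPart W) (hV1 : ‖V - 1‖ ≤ 1 / 4) (hW1 : ‖W - 1‖ ≤ 1 / 4) : V = W := by
  obtain ⟨D, rfl⟩ : ∃ D, W = V + D := ⟨W - V, by abel⟩
  have hD : Dᵀ = D := by
    have h2 : V - Vᵀ = (V + D) - (V + D)ᵀ := by
      have := congrArg (fun A : Mat n => (2 : ℝ) • A) hVW
      simpa [skewPart, smul_smul] using this
    rw [transpose_add] at h2
    have h3 : (V - Vᵀ) + (D - Dᵀ) = V - Vᵀ := by
      refine Eq.trans ?_ h2.symm
      abel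
    exact (sub_eq_zero.1 (add_eq_left.1 h3)).symm
  -- The difference D is symmetric, and orthogonality of V + D gives a quadratic equation for it.
  -- With V near 1 its linear part is close to 2 D, so a small solution must vanish.
  have h1 : Vᵀ * D + D * V + D * D = 0 := by
    rw [transpose_add, hD, Matrix.add_mul, Matrix.mul_add, Matrix.mul_add, hV] at hW
    have : (1 : Mat n) + (Vᵀ * D + D * V + D * D) = 1 := by
      rw [add_assoc, ← add_assoc]; exact hW
    exact add_eq_left.1 this
  have h2 : (2 : ℝ) • D = -((V - 1)ᵀ * D + D * (V - 1) + D * D) := by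
    have : (V - 1)ᵀ * D + D * (V - 1) + D * D = (Vᵀ * D + D * V + D * D) - (2 : ℝ) • D := by
      rw [transpose_sub, transpose_one, Matrix.sub_mul, Matrix.mul_sub, Matrix.one_mul,
        Matrix.mul_one]
      module
    rw [this, h1, zero_sub, neg_neg]
  have hDn : ‖D‖ ≤ 1 / 2 := by
    have : D = (V + D - 1) - (V - 1) := by abel
    rw [this]
    exact (norm_sub_le _ _).trans (by linarith)
  have h3 : 2 * ‖D‖ ≤ ‖D‖ := by
    calc 2 * ‖D‖ = ‖(2 : ℝ) • D‖ := by rw [norm_smul]; norm_num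
      _ ≤ ‖(V - 1)ᵀ‖ * ‖D‖ + ‖D‖ * ‖V - 1‖ + ‖D‖ * ‖D‖ := by
        rw [h2, norm_neg]
        exact (norm_add₃_le ..).trans (add_le_add_three (frobenius_norm_mul _ _)
          (frobenius_norm_mul _ _) (frobenius_norm_mul _ _))
      _ ≤ 1 / 4 * ‖D‖ + ‖D‖ * (1 / 4) + ‖D‖ * (1 / 2) := by
        rw [frobenius_norm_transpose]; gcongr
      _ = ‖D‖ := by ring
  have : ‖D‖ = 0 := le_antisymm (by linarith) (norm_nonneg _)
  rw [norm_eq_zero.1 this, add_zero]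

end ChartInjective

/-! ### Perturbations of the identity in a Banach space. -/

section Perturbation

variable {E : Type*} [NormedAddCommGroup E] [NormedSpace ℝ E]

/-- A map with bounded second differences and vanishing derivative at `0` has a small Lipschitz
constant near `0`. -/
theorem norm_sub_le_of_second_difference {p : E → E} {M ε : ℝ} (hM : 0 ≤ M)
    (hd : Differentiable ℝ p) (h0 : fderiv ℝ p 0 = 0)
    (h2 : ∀ x d e, ‖p (x + d + e) - p (x + d) - p (x + e) + p x‖ ≤ M * ‖d‖ * ‖e‖)
    {x y : E} (hx : x ∈ Metric.ball (0 : E) ε) (hy : y ∈ Metric.ball (0 : E) ε) :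
    ‖p x - p y‖ ≤ M * ε * ‖x - y‖ := by
  refine (convex_ball (0 : E) ε).norm_image_sub_le_of_norm_fderiv_le (𝕜 := ℝ)
    (fun z _ => hd z) (fun z hz => ?_) hy hx
  -- As p has derivative 0 at the origin, its derivative at z is that of a first difference, which
  -- the second difference bound makes Lipschitz at 0.
  have h3 : HasFDerivAt (fun e => p (z + e) - p e) (fderiv ℝ p z - fderiv ℝ p 0) 0 := by
    refine HasFDerivAt.sub ?_ (hd 0).hasFDerivAt
    have h4 : HasFDerivAt p (fderiv ℝ p z) (z + 0) := by
      rw [add_zero]; exact (hd z).hasFDerivAt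
    exact h4.comp 0 ((hasFDerivAt_id 0).const_add z)
  rw [h0, sub_zero] at h3
  refine (h3.le_of_lip' (C := M * ‖z‖) (by positivity) (Eventually.of_forall fun e => ?_)).trans
    (mul_le_mul_of_nonneg_left (mem_ball_zero_iff.1 hz).le hM)
  have h4 := h2 0 z e
  simp only [zero_add] at h4
  rw [sub_zero, add_zero]
  refine (le_of_eq ?_).trans h4
  congr 1
  abel

variable [CompleteSpace E]

/-- If `F` is a perturbation of the identity and `G` is close to `F`, the equation `F x = G y` has
a solution `x = y + e y` with `e` small in Lipschitz norm. -/
theorem exists_solution_near {F G : E → E} {M l ε r : ℝ} (hM : 0 ≤ M) (hr : 0 < r)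
    (hd : Differentiable ℝ F) (h0 : fderiv ℝ F 0 = ContinuousLinearMap.id ℝ E)
    (h2 : ∀ x d e, ‖F (x + d + e) - F (x + d) - F (x + e) + F x‖ ≤ M * ‖d‖ * ‖e‖)
    (hMε : M * ε ≤ 1 / 2)
    (hG : ∀ y ∈ Metric.ball (0 : E) ε, ‖G y - F y‖ ≤ r / 4)
    (hGl : ∀ y ∈ Metric.ball (0 : E) ε, ∀ z ∈ Metric.ball (0 : E) ε,
      ‖(G y - F y) - (G z - F z)‖ ≤ l * ‖y - z‖) :
    ∃ e : E → E, ∀ y ∈ Metric.ball (0 : E) (ε - r), ‖e y‖ ≤ r / 2 ∧ F (y + e y) = G y ∧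
      ∀ z ∈ Metric.ball (0 : E) (ε - r), ‖e y - e z‖ ≤ 2 * (l + M * r) * ‖y - z‖ := by
  have hr2 : 0 ≤ r / 2 := by linarith
  set p : E → E := fun x => F x - x with hp
  have hpL : ∀ x ∈ Metric.ball (0 : E) ε, ∀ y ∈ Metric.ball (0 : E) ε,
      ‖p x - p y‖ ≤ 1 / 2 * ‖x - y‖ := by
    intro x hx y hy
    refine (norm_sub_le_of_second_difference hM (hd.sub differentiable_id) ?_ ?_ hx hy).trans
      (mul_le_mul_of_nonneg_right hMε (norm_nonneg _))
    · have : HasFDerivAt p (fderiv ℝ F 0 - ContinuousLinearMap.id ℝ E) 0 :=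
        (hd 0).hasFDerivAt.sub (hasFDerivAt_id 0)
      rw [h0, sub_self] at this
      exact this.fderiv
    · intro x d e
      refine (le_of_eq ?_).trans (h2 x d e)
      congr 1
      simp only [Pi.sub_apply, id]
      abel
  have hball : ∀ y ∈ Metric.ball (0 : E) (ε - r), ∀ e : E, ‖e‖ ≤ r / 2 →
      y + e ∈ Metric.ball (0 : E) ε := by
    intro y hy e he
    rw [mem_ball_zero_iff] at hy ⊢
    linarith [norm_add_le y e]
  have hex : ∀ y ∈ Metric.ball (0 : E) (ε - r), ∃ e : E, ‖e‖ ≤ r / 2 ∧ F (y + e) = G y := by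
    intro y hy
    have hyε : y ∈ Metric.ball (0 : E) ε := by simpa using hball y hy 0 (by simpa using hr2)
    -- Half of the radius r/2 pays for F - id, which is 1/2-Lipschitz, and the other half for G - F.
    have hmaps : Set.MapsTo (fun e => e - F (y + e) + G y) (Metric.closedBall (0 : E) (r / 2))
        (Metric.closedBall (0 : E) (r / 2)) := by
      intro e he
      rw [mem_closedBall_zero_iff] at he ⊢
      have h3 : e - F (y + e) + G y = -(p (y + e) - p y) + (G y - F y) := by
        simp only [hp]; abel
      have h4 := hpL _ (hball y hy e he) _ hyε
      rw [add_sub_cancel_left] at h4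
      refine (congrArg norm h3).le.trans ((norm_add_le _ _).trans ?_)
      rw [norm_neg]
      linarith [hG y hyε]
    have hcontr : ContractingWith (1 / 2) (hmaps.restrict _ _ _) := by
      refine ⟨by norm_num, LipschitzWith.of_dist_le_mul ?_⟩
      rintro ⟨a, ha⟩ ⟨b, hb⟩
      rw [mem_closedBall_zero_iff] at ha hb
      simp only [Subtype.dist_eq, Set.MapsTo.val_restrict_apply, dist_eq_norm]
      have h3 : a - F (y + a) + G y - (b - F (y + b) + G y) = -(p (y + a) - p (y + b)) := by
        simp only [hp]; abel
      rw [h3, norm_neg]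
      have h4 := hpL _ (hball y hy a ha) _ (hball y hy b hb)
      rw [add_sub_add_left_eq_sub] at h4
      simpa using h4
    obtain ⟨e, he, hfix, -⟩ := hcontr.exists_fixedPoint' (Metric.isClosed_closedBall.isComplete)
      hmaps (x := 0) (by simpa using hr2) (edist_ne_top _ _)
    refine ⟨e, by simpa using he, ?_⟩
    have h3 : e - F (y + e) + G y = e := hfix
    have h4 : e - (F (y + e) - G y) = e - 0 := by rw [sub_zero, ← sub_add]; exact h3
    exact sub_eq_zero.1 (sub_right_injective h4)
  choose! e he using hex
  refine ⟨e, fun y hy => ⟨(he y hy).1, (he y hy).2, fun z hz => ?_⟩⟩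
  obtain ⟨hy1, hy2⟩ := he y hy
  obtain ⟨hz1, hz2⟩ := he z hz
  have hyε : y ∈ Metric.ball (0 : E) ε := by simpa using hball y hy 0 (by simpa using hr2)
  have hzε : z ∈ Metric.ball (0 : E) ε := by simpa using hball z hz 0 (by simpa using hr2)
  -- The three terms are bounded by l, by the second difference of F with increments y - z and e y,
  -- and by half of the left side, which is absorbed.
  have h3 : e y - e z = ((G y - F y) - (G z - F z))
      - (F (z + (y - z) + e y) - F (z + (y - z)) - F (z + e y) + F z)
      - (p (z + e y) - p (z + e z)) := by
    rw [add_sub_cancel, hy2]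
    simp only [hp]
    rw [hz2]
    abel
  have h4 := hGl y hyε z hzε
  have h5 := h2 z (y - z) (e y)
  have h6 := hpL _ (hball z hz _ hy1) _ (hball z hz _ hz1)
  rw [add_sub_add_left_eq_sub] at h6
  have h7 : M * ‖y - z‖ * ‖e y‖ ≤ M * ‖y - z‖ * r :=
    mul_le_mul_of_nonneg_left (hy1.trans (by linarith)) (by positivity)
  have h8 := (congrArg norm h3).le.trans ((norm_sub_le _ _).trans
    (add_le_add_left (norm_sub_le _ _) _))
  linarith

end Perturbation

/-! ### Coupling uniform vectors through a near-identity map. -/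

section Coupling

open scoped ENNReal NNReal

/-- If a part `ρ` of `μ` is mapped by `K` into a part of `μ`, then there is a coupling of `μ` with
itself for which the first component is the image of the second with probability at least the
mass of `ρ`. -/
theorem exists_coupling_of_map_le {α : Type*} [MeasurableSpace α] (μ ρ : Measure α)
    [IsProbabilityMeasure μ] {K : α → α} (hK : Measurable K) (hρ : ρ ≤ μ) (hρK : ρ.map K ≤ μ)
    (hρ1 : ρ Set.univ < 1) :
    ∃ P : Measure (α × α), P.map Prod.fst = μ ∧ P.map Prod.snd = μ ∧
      ∀ S, MeasurableSet S → (∀ᵐ y ∂ρ, (K y, y) ∉ S) → P S ≤ 1 - ρ Set.univ := by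
  have : IsFiniteMeasure ρ := ⟨hρ1.trans ENNReal.one_lt_top⟩
  set m := ρ Set.univ with hm
  have hm0 : 1 - m ≠ 0 := (tsub_pos_of_lt hρ1).ne'
  have hmt : 1 - m ≠ ∞ := ne_top_of_le_ne_top ENNReal.one_ne_top tsub_le_self
  have hKu : ρ.map K Set.univ = m := by rw [Measure.map_apply hK .univ, Set.preimage_univ]
  have h1 : (μ - ρ.map K) Set.univ = 1 - m := by
    rw [Measure.sub_apply .univ hρK, measure_univ, hKu]
  have h2 : (μ - ρ) Set.univ = 1 - m := by rw [Measure.sub_apply .univ hρ, measure_univ]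
  have hpair : Measurable fun y => (K y, y) := hK.prodMk measurable_id
  -- The part ρ sits on the graph of K, and the two remainders, both of mass 1 - m, are coupled
  -- independently. The normalisation needs m < 1.
  refine ⟨ρ.map (fun y => (K y, y)) + (1 - m)⁻¹ • (μ - ρ.map K).prod (μ - ρ), ?_, ?_, ?_⟩
  · rw [Measure.map_add _ _ measurable_fst, Measure.map_smul, Measure.map_fst_prod, h2, smul_smul,
      ENNReal.inv_mul_cancel hm0 hmt, one_smul, Measure.map_map measurable_fst hpair]
    exact (add_comm _ _).trans (Measure.sub_add_cancel_of_le hρK)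
  · rw [Measure.map_add _ _ measurable_snd, Measure.map_smul, Measure.map_snd_prod, h1, smul_smul,
      ENNReal.inv_mul_cancel hm0 hmt, one_smul, Measure.map_map measurable_snd hpair]
    have : Prod.snd ∘ (fun y => (K y, y)) = id := rfl
    rw [this, Measure.map_id]
    exact (add_comm _ _).trans (Measure.sub_add_cancel_of_le hρ)
  · intro S hS hS0
    have h3 : ρ.map (fun y => (K y, y)) S = 0 := by
      rw [Measure.map_apply hpair hS]
      exact measure_eq_zero_iff_ae_notMem.2 hS0
    rw [Measure.add_apply, h3, zero_add, Measure.smul_apply, smul_eq_mul]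
    calc (1 - m)⁻¹ * (μ - ρ.map K).prod (μ - ρ) S
        ≤ (1 - m)⁻¹ * (μ - ρ.map K).prod (μ - ρ) Set.univ := by
          gcongr; exact Set.subset_univ S
      _ = 1 - m := by
          rw [← Set.univ_prod_univ, Measure.prod_prod, h1, h2, ← mul_assoc,
            ENNReal.inv_mul_cancel hm0 hmt, one_mul]

variable {N : ℕ}

theorem pi_uniform_eq {ε : ℝ} (hε : 0 < ε) :
    Measure.pi (fun _ : Fin N => ProbabilityTheory.cond volume (Set.Ioo (-ε) ε)) =
      (volume (Metric.ball (0 : Fin N → ℝ) ε))⁻¹ •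
        (volume : Measure (Fin N → ℝ)).restrict (Metric.ball 0 ε) := by
  have hb : Metric.ball (0 : Fin N → ℝ) ε = Set.univ.pi fun _ => Set.Ioo (-ε) ε := by
    rw [ball_pi _ hε]; simp [Real.ball_eq_Ioo]
  have hv : volume (Set.Ioo (-ε) ε) ≠ 0 := by simp [hε]
  have hv' : volume (Set.Ioo (-ε) ε) ≠ ∞ := by simp
  have := cond_isProbabilityMeasure_of_finite hv hv'
  refine Measure.pi_eq fun s hs => ?_
  rw [Measure.smul_apply, hb, volume_pi, Measure.restrict_pi_pi, Measure.pi_pi, Measure.pi_pi,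
    smul_eq_mul, ENNReal.prod_inv_distrib (fun _ _ _ _ _ => Or.inl hv), ← Finset.prod_mul_distrib]
  rfl

/-- Almost isometric perturbations of the identity do not increase Lebesgue measure by much. -/
theorem map_restrict_ball_le {ε r : ℝ} {k : ℝ≥0} (hk : k < 1) {K : (Fin N → ℝ) → Fin N → ℝ}
    (hK : Measurable K)
    (hmaps : Set.MapsTo K (Metric.ball 0 (ε - r)) (Metric.ball 0 ε))
    (hanti : ∀ y ∈ Metric.ball (0 : Fin N → ℝ) (ε - r), ∀ z ∈ Metric.ball (0 : Fin N → ℝ) (ε - r),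
      (1 - k : ℝ) * ‖y - z‖ ≤ ‖K y - K z‖) :
    ((((1 - k) ^ N : ℝ≥0) : ℝ≥0∞) • (volume : Measure (Fin N → ℝ)).restrict
      (Metric.ball 0 (ε - r))).map K ≤ (volume : Measure (Fin N → ℝ)).restrict (Metric.ball 0 ε) := by
  refine Measure.le_iff.2 fun B hB => ?_
  have hk1 : ((1 - k : ℝ≥0) : ℝ) = 1 - k := NNReal.coe_sub hk.le
  have hk0 : 0 < 1 - k := tsub_pos_of_lt hk
  have hk0' : (0 : ℝ) < 1 - k := by rw [← hk1]; exact_mod_cast hk0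
  set Q : Set (Fin N → ℝ) := Metric.ball 0 (ε - r)
  set A := K ⁻¹' B ∩ Q with hA
  have hinj : Set.InjOn K Q := by
    intro y hy z hz hyz
    have h := hanti y hy z hz
    rw [hyz, sub_self, norm_zero] at h
    have : ‖y - z‖ = 0 := le_antisymm (by nlinarith [norm_nonneg (y - z)]) (norm_nonneg _)
    exact sub_eq_zero.1 (norm_eq_zero.1 this)
  have hAQ : A ⊆ Q := Set.inter_subset_right
  have hleft : Set.LeftInvOn (Function.invFunOn K Q) K Q := hinj.leftInvOn_invFunOn
  have hlip : LipschitzOnWith (1 - k)⁻¹ (Function.invFunOn K Q) (K '' A) := by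
    refine LipschitzOnWith.of_dist_le_mul ?_
    rintro _ ⟨y, hy, rfl⟩ _ ⟨z, hz, rfl⟩
    rw [hleft (hAQ hy), hleft (hAQ hz), dist_eq_norm, dist_eq_norm, NNReal.coe_inv, hk1,
      ← div_eq_inv_mul, le_div_iff₀ hk0', mul_comm]
    exact hanti y (hAQ hy) z (hAQ hz)
  -- In the sup norm, N-dimensional Hausdorff measure is Lebesgue measure, so the Lipschitz inverse
  -- of K bounds volumes without a change of variables.
  have hvol := hlip.hausdorffMeasure_image_le (d := (Fintype.card (Fin N) : ℝ)) (by positivity)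
  rw [hausdorffMeasure_pi_real, (hleft.mono hAQ).image_image, Fintype.card_fin,
    ENNReal.rpow_natCast] at hvol
  have hsub : K '' A ⊆ B ∩ Metric.ball 0 ε := by
    rintro _ ⟨y, hy, rfl⟩
    exact ⟨hy.1, hmaps hy.2⟩
  rw [Measure.map_apply hK hB, Measure.smul_apply, Measure.restrict_apply (hK hB),
    Measure.restrict_apply hB, smul_eq_mul]
  calc (((1 - k) ^ N : ℝ≥0) : ℝ≥0∞) * volume A
      ≤ (((1 - k) ^ N : ℝ≥0) : ℝ≥0∞) * ((((1 - k)⁻¹ : ℝ≥0) : ℝ≥0∞) ^ N * volume (K '' A)) := by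
        gcongr
    _ = volume (K '' A) := by
        rw [← mul_assoc, ← ENNReal.coe_pow, ← ENNReal.coe_mul, ← mul_pow,
          mul_inv_cancel₀ hk0.ne', one_pow, ENNReal.coe_one, one_mul]
    _ ≤ _ := measure_mono hsub

/-- Two uniform random vectors of a cube can be coupled so that one is a given small perturbation
of the other with high probability. -/
theorem exists_uniform_coupling {ε r : ℝ} {k : ℝ≥0} (hN : 0 < N) (hr : 0 < r) (hrε : r < ε)
    (hk : k < 1) {e : (Fin N → ℝ) → Fin N → ℝ}
    (he : ∀ y ∈ Metric.ball (0 : Fin N → ℝ) (ε - r), ‖e y‖ ≤ r)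
    (hek : ∀ y ∈ Metric.ball (0 : Fin N → ℝ) (ε - r), ∀ z ∈ Metric.ball (0 : Fin N → ℝ) (ε - r),
      ‖e y - e z‖ ≤ k * ‖y - z‖) :
    ∃ P : Measure ((Fin N → ℝ) × (Fin N → ℝ)),
      P.map Prod.fst = Measure.pi (fun _ => ProbabilityTheory.cond volume (Set.Ioo (-ε) ε)) ∧
      P.map Prod.snd = Measure.pi (fun _ => ProbabilityTheory.cond volume (Set.Ioo (-ε) ε)) ∧
      ∀ S, MeasurableSet S → (∀ y ∈ Metric.ball (0 : Fin N → ℝ) (ε - r), (y + e y, y) ∉ S) →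
        P S ≤ ENNReal.ofReal (N * (k + r / ε)) := by
  have hε : 0 < ε := hr.trans hrε
  have hk1 : ((1 - k : ℝ≥0) : ℝ) = 1 - k := NNReal.coe_sub hk.le
  have hk0 : 0 < 1 - k := tsub_pos_of_lt hk
  have hk0' : (0 : ℝ) < 1 - k := by rw [← hk1]; exact_mod_cast hk0
  set Q : Set (Fin N → ℝ) := Metric.ball 0 (ε - r) with hQ
  set Q₁ : Set (Fin N → ℝ) := Metric.ball 0 ε with hQ₁
  have hQQ : Q ⊆ Q₁ := Metric.ball_subset_ball (by linarith)
  have hvQ : volume Q = ENNReal.ofReal ((2 * (ε - r)) ^ N) := by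
    rw [hQ, Real.volume_pi_ball _ (sub_pos.2 hrε), Fintype.card_fin]
  have hvQ₁ : volume Q₁ = ENNReal.ofReal ((2 * ε) ^ N) := by
    rw [hQ₁, Real.volume_pi_ball _ hε, Fintype.card_fin]
  have hlip : LipschitzOnWith (1 + k) (fun y => y + e y) Q := by
    refine LipschitzOnWith.of_dist_le_mul fun y hy z hz => ?_
    rw [dist_eq_norm, dist_eq_norm, add_sub_add_comm, NNReal.coe_add, NNReal.coe_one, add_mul,
      one_mul]
    exact (norm_add_le _ _).trans (add_le_add_right (hek y hy z hz) _)
  -- The map id + e is controlled only on the smaller cube; a Lipschitz extension makes it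
  -- measurable everywhere.
  obtain ⟨K, hKlip, hKe⟩ := hlip.extend_pi
  have hKm : Measurable K := hKlip.continuous.measurable
  have hmaps : Set.MapsTo K Q Q₁ := by
    intro y hy
    rw [← hKe hy, hQ₁, mem_ball_zero_iff]
    have h1 := he y hy
    rw [hQ, mem_ball_zero_iff] at hy
    exact (norm_add_le _ _).trans_lt (by linarith)
  have hanti : ∀ y ∈ Q, ∀ z ∈ Q, (1 - k : ℝ) * ‖y - z‖ ≤ ‖K y - K z‖ := by
    intro y hy z hz
    rw [← hKe hy, ← hKe hz]
    have h1 : y - z = (y + e y - (z + e z)) - (e y - e z) := by abel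
    have h2 := (congrArg norm h1).le.trans (norm_sub_le _ _)
    have h3 := hek y hy z hz
    linarith
  set μ := Measure.pi (fun _ : Fin N => ProbabilityTheory.cond volume (Set.Ioo (-ε) ε)) with hμ
  have hv : volume (Set.Ioo (-ε) ε) ≠ 0 := by simp [hε]
  have := cond_isProbabilityMeasure_of_finite hv (by simp)
  have hμ' : μ = (volume Q₁)⁻¹ • volume.restrict Q₁ := pi_uniform_eq hε
  set c : ℝ≥0∞ := (((1 - k) ^ N : ℝ≥0) : ℝ≥0∞) with hc
  have hc1 : c ≤ 1 := by
    rw [hc, ENNReal.coe_le_one_iff]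
    exact pow_le_one₀ zero_le tsub_le_self
  -- The factor (1 - k)^N offsets the largest increase of density under K, so that the image of ρ
  -- still lies below μ.
  set ρ := (volume Q₁)⁻¹ • c • volume.restrict Q with hρdef
  have hmass : ρ Set.univ = ENNReal.ofReal (((1 - k) * ((ε - r) / ε)) ^ N) := by
    have hcr : c = ENNReal.ofReal ((1 - k) ^ N) := by
      rw [hc, ← hk1, ← NNReal.coe_pow, ENNReal.ofReal_coe_nnreal]
    rw [hρdef, Measure.smul_apply, Measure.smul_apply, Measure.restrict_apply_univ, hvQ, hvQ₁,
      smul_eq_mul, smul_eq_mul, hcr, ← ENNReal.ofReal_inv_of_pos (by positivity),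
      ← ENNReal.ofReal_mul (by positivity), ← ENNReal.ofReal_mul (by positivity)]
    congr 1
    rw [← inv_pow, ← mul_pow, ← mul_pow]
    congr 1
    field_simp
  have hq : (1 - k : ℝ) * ((ε - r) / ε) < 1 := by
    have h1 : (ε - r) / ε < 1 := by rw [div_lt_one hε]; linarith
    have h2 : 0 < (ε - r) / ε := div_pos (by linarith) hε
    nlinarith [k.2]
  have hq0 : 0 ≤ (1 - k : ℝ) * ((ε - r) / ε) :=
    mul_nonneg hk0'.le (div_nonneg (by linarith) hε.le)
  have hρ1 : ρ Set.univ < 1 := by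
    rw [hmass, ← ENNReal.ofReal_one]
    exact (ENNReal.ofReal_lt_ofReal_iff one_pos).2 (pow_lt_one₀ hq0 hq hN.ne')
  have hρμ : ρ ≤ μ := by
    rw [hμ', hρdef]
    gcongr
    calc c • volume.restrict Q ≤ (1 : ℝ≥0∞) • volume.restrict Q := by gcongr
      _ = volume.restrict Q := one_smul _ _
      _ ≤ volume.restrict Q₁ := Measure.restrict_mono hQQ le_rfl
  have hρK : ρ.map K ≤ μ := by
    rw [hμ', hρdef, Measure.map_smul]
    gcongr
    exact map_restrict_ball_le hk hKm hmaps hanti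
  obtain ⟨P, h1, h2, h3⟩ := exists_coupling_of_map_le μ ρ hKm hρμ hρK hρ1
  refine ⟨P, h1, h2, fun S hS hSe => (h3 S hS ?_).trans ?_⟩
  · rw [hρdef]
    refine Measure.ae_smul_measure (Measure.ae_smul_measure ?_ _) _
    refine (ae_restrict_iff' Metric.isOpen_ball.measurableSet).2 (Eventually.of_forall ?_)
    intro y hy
    rw [← hKe hy]
    exact hSe y hy
  · rw [hmass, ← ENNReal.ofReal_one, ← ENNReal.ofReal_sub _ (pow_nonneg hq0 _)]
    refine ENNReal.ofReal_le_ofReal ?_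
    -- Bernoulli's inequality; the product k r/ε has the favourable sign and is dropped.
    have hb := one_add_mul_le_pow (a := (1 - k : ℝ) * ((ε - r) / ε) - 1) (by linarith) N
    rw [add_sub_cancel] at hb
    have h4 : (1 - k : ℝ) * ((ε - r) / ε) - 1 = -(k + r / ε) + k * (r / ε) := by
      field_simp; ring
    have h5 : (0 : ℝ) ≤ N * (k * (r / ε)) := by positivity
    rw [h4] at hb
    linarith

end Coupling

/-! ### Angle shifts at the marked times. -/

section MarkedTimes

variable {N : ℕ} (s : Fin N → ℕ)

/-- The angle by which the coordinates `x` perturb the path at each time. -/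
def markShift (x : Fin N → ℝ) (t : ℕ) : ℝ := ∑ l, if s l = t then x l else 0

theorem markShift_add (x y : Fin N → ℝ) : markShift s (x + y) = markShift s x + markShift s y := by
  ext t
  simp only [markShift, Pi.add_apply, ← Finset.sum_add_distrib]
  exact Finset.sum_congr rfl fun l _ => by split_ifs <;> simp

theorem markShift_sub_apply (x y : Fin N → ℝ) (t : ℕ) :
    markShift s x t - markShift s y t = markShift s (x - y) t := by
  simp only [markShift, Pi.sub_apply, ← Finset.sum_sub_distrib]
  exact Finset.sum_congr rfl fun l _ => by split_ifs <;> simp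

theorem sum_abs_markShift_le (x : Fin N → ℝ) (t : ℕ) :
    ∑ τ ∈ Finset.range t, |markShift s x τ| ≤ N * ‖x‖ := by
  calc ∑ τ ∈ Finset.range t, |markShift s x τ|
      ≤ ∑ τ ∈ Finset.range t, ∑ l, |if s l = τ then x l else 0| :=
        Finset.sum_le_sum fun τ _ => Finset.abs_sum_le_sum_abs _ _
    _ = ∑ l, ∑ τ ∈ Finset.range t, |if s l = τ then x l else 0| := Finset.sum_comm
    _ ≤ ∑ _l : Fin N, ‖x‖ := Finset.sum_le_sum fun l _ => by
        simp only [apply_ite abs, abs_zero, Finset.sum_ite_eq]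
        split_ifs
        · exact norm_le_pi_norm x l
        · exact norm_nonneg x
    _ = N * ‖x‖ := by simp

end MarkedTimes

/-! ### Regularity and comparison of perturbation maps. -/

section InducedMap

variable {n : ℕ} {T : ℕ} {s : Fin (numPlanes n) → ℕ} {i : ℕ → Plane n}

theorem inducedMap_eq {X : Mat n} (hX : Xᵀ * X = 1) (η : ℕ → ℝ) (x : Fin (numPlanes n) → ℝ) :
    inducedMap X T s i η (WithLp.toLp 2 x) =
      path i η X T * frameProd i (path i η X) (markShift s x) T :=
  path_add_eq i η (markShift s x) hX T

theorem inducedMap_zero {X : Mat n} (η : ℕ → ℝ) : inducedMap X T s i η 0 = path i η X T := by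
  simp [inducedMap]

theorem inducedMap_orthogonal {X : Mat n} (hX : Xᵀ * X = 1) (η : ℕ → ℝ)
    (x : EuclideanSpace ℝ (Fin (numPlanes n))) :
    (inducedMap X T s i η x)ᵀ * inducedMap X T s i η x = 1 :=
  path_orthogonal i _ hX T

theorem differentiable_rotation_apply (p : Plane n) (a b : Fin n) :
    Differentiable ℝ fun θ => rotation p θ a b := by
  simp only [rotation, of_apply]
  split_ifs <;> fun_prop

theorem differentiable_path_apply {E : Type*} [NormedAddCommGroup E] [NormedSpace ℝ E]
    {θ : E → ℕ → ℝ} (hθ : ∀ t, Differentiable ℝ fun x => θ x t) (X : Mat n) (t : ℕ)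
    (a b : Fin n) : Differentiable ℝ fun x => path i (θ x) X t a b := by
  induction t generalizing a b with
  | zero => simp [path]
  | succ t ih =>
    simp only [path, mul_apply]
    exact Differentiable.fun_sum fun c _ =>
      ((differentiable_rotation_apply (i t) a c).comp (hθ t)).mul (ih c b)

theorem differentiable_inducedMap (X : Mat n) (η : ℕ → ℝ) :
    Differentiable ℝ (inducedMap X T s i η) := by
  refine differentiable_pi.2 fun a => differentiable_pi.2 fun b => ?_
  refine differentiable_path_apply (fun t => ?_) X T a b
  refine (differentiable_const _).add (Differentiable.fun_sum fun l _ => ?_)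
  split_ifs <;> fun_prop

theorem norm_inducedMap_sub_le {X : Mat n} (hX : Xᵀ * X = 1) (η : ℕ → ℝ)
    (x y : Fin (numPlanes n) → ℝ) :
    ‖inducedMap X T s i η (WithLp.toLp 2 x) - inducedMap X T s i η (WithLp.toLp 2 y)‖ ≤
      2 * numPlanes n * ‖x - y‖ := by
  rw [inducedMap_eq hX, inducedMap_eq hX, ← Matrix.mul_sub,
    norm_orthogonal_mul (path_orthogonal i η hX T)]
  refine (norm_frameProd_sub_le (path_orthogonal i η hX) T).trans ?_
  simp only [markShift_sub_apply]
  linarith [sum_abs_markShift_le s (x - y) T]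

theorem norm_inducedMap_second_difference_le {X : Mat n} (hX : Xᵀ * X = 1) (η : ℕ → ℝ)
    (x d e : Fin (numPlanes n) → ℝ) :
    ‖inducedMap X T s i η (WithLp.toLp 2 (x + d + e)) - inducedMap X T s i η (WithLp.toLp 2 (x + d))
        - inducedMap X T s i η (WithLp.toLp 2 (x + e)) + inducedMap X T s i η (WithLp.toLp 2 x)‖ ≤
      4 * (numPlanes n : ℝ) ^ 2 * ‖d‖ * ‖e‖ := by
  simp only [inducedMap_eq hX, markShift_add]
  rw [← Matrix.mul_sub, ← Matrix.mul_sub, ← Matrix.mul_add,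
    norm_orthogonal_mul (path_orthogonal i η hX T)]
  refine (norm_frameProd_second_difference_le (path_orthogonal i η hX) T).trans ?_
  calc _ ≤ 4 * (numPlanes n * ‖d‖) * (numPlanes n * ‖e‖) := by
        gcongr <;> exact sum_abs_markShift_le s _ T
    _ = _ := by ring

/-- The constant is 14 = 4 · 3 + 2: the first term compares the conjugated products, with 1 + 4 N ε
≤ 3, and the second the unperturbed endpoints. -/
theorem norm_inducedMap_diff_sub_le {X Y : Mat n} (hX : Xᵀ * X = 1) (hY : Yᵀ * Y = 1)
    (η η' : ℕ → ℝ) {w ε : ℝ} (hw : ∀ t ≤ T, ‖path i η X t - path i η' Y t‖ ≤ w)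
    (hε : 2 * numPlanes n * ε ≤ 1) {x y : Fin (numPlanes n) → ℝ} (hx : ‖x‖ ≤ ε) (hy : ‖y‖ ≤ ε) :
    ‖(inducedMap Y T s i η' (WithLp.toLp 2 x) - inducedMap X T s i η (WithLp.toLp 2 x))
        - (inducedMap Y T s i η' (WithLp.toLp 2 y) - inducedMap X T s i η (WithLp.toLp 2 y))‖ ≤
      14 * numPlanes n * w * ‖x - y‖ := by
  have hw0 : 0 ≤ w := (norm_nonneg _).trans (hw T le_rfl)
  have oX := path_orthogonal i η hX
  have oY := path_orthogonal i η' hY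
  simp only [inducedMap_eq hX, inducedMap_eq hY]
  have h : ∀ A B C D E F : Mat n, B * D - A * C - (B * F - A * E) =
      -(B * ((C - D) - (E - F)) + (A - B) * (C - E)) := by
    intros; noncomm_ring
  rw [h, norm_neg]
  refine (norm_add_le _ _).trans ?_
  rw [norm_orthogonal_mul (oY T)]
  have hN : (0 : ℝ) ≤ numPlanes n := Nat.cast_nonneg _
  have h1 := norm_frameProd_diff_sub_le (i := i) (c := markShift s x) (c' := markShift s y)
    oX oY hw0 (t := T) fun τ hτ => hw τ hτ.le
  have h2 := norm_frameProd_sub_le (i := i) (c := markShift s x) (c' := markShift s y) oX T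
  have h3 := frobenius_norm_mul (path i η X T - path i η' Y T)
    (frameProd i (path i η X) (markShift s x) T - frameProd i (path i η X) (markShift s y) T)
  simp only [markShift_sub_apply, Finset.sum_add_distrib] at h1 h2
  have s1 := sum_abs_markShift_le s (x - y) T
  have s2 := sum_abs_markShift_le s x T
  have s3 := sum_abs_markShift_le s y T
  have h4 : 4 * w * (∑ τ ∈ Finset.range T, |markShift s (x - y) τ|) *
      (1 + 2 * (∑ τ ∈ Finset.range T, |markShift s x τ| + ∑ τ ∈ Finset.range T, |markShift s y τ|))
      ≤ 4 * w * (numPlanes n * ‖x - y‖) * 3 := by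
    gcongr
    have := mul_le_mul_of_nonneg_left hx hN
    have := mul_le_mul_of_nonneg_left hy hN
    linarith
  have h5 : ‖path i η X T - path i η' Y T‖ *
      ‖frameProd i (path i η X) (markShift s x) T - frameProd i (path i η X) (markShift s y) T‖ ≤
      w * (2 * (numPlanes n * ‖x - y‖)) := by
    gcongr
    · exact hw T le_rfl
    · linarith
  linarith

end InducedMap

/-! ### Linear charts of the orthogonal group. -/

section Chart

variable {n : ℕ}

/-- The coordinates of the skew-symmetric part of a matrix. -/
noncomputable def skewCoord : Mat n →ₗ[ℝ] Plane n → ℝ where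
  toFun A p := (A p.1.1 p.1.2 - A p.1.2 p.1.1) / 2
  map_add' A B := by ext p; simp; ring
  map_smul' c A := by ext p; simp; ring

theorem skewCoord_apply (A : Mat n) (p : Plane n) :
    skewCoord A p = (A p.1.1 p.1.2 - A p.1.2 p.1.1) / 2 := rfl

theorem norm_skewCoord_le (A : Mat n) : ‖skewCoord A‖ ≤ ‖A‖ := by
  refine (pi_norm_le_iff_of_nonneg (norm_nonneg _)).2 fun p => ?_
  rw [skewCoord_apply, Real.norm_eq_abs, abs_le]
  have h1 := abs_le.1 (abs_apply_le_norm A p.1.1 p.1.2)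
  have h2 := abs_le.1 (abs_apply_le_norm A p.1.2 p.1.1)
  constructor <;> linarith

theorem abs_skewPart_apply_le (A : Mat n) (a b : Fin n) : |skewPart A a b| ≤ ‖skewCoord A‖ := by
  have h : skewPart A a b = (A a b - A b a) / 2 := by simp [skewPart]; ring
  rw [h]
  rcases lt_trichotomy a b with hab | rfl | hab
  · exact norm_le_pi_norm (skewCoord A) ⟨(a, b), hab⟩
  · simp
  · have := norm_le_pi_norm (skewCoord A) ⟨(b, a), hab⟩
    rwa [skewCoord_apply, Real.norm_eq_abs, ← abs_neg, ← neg_div, neg_sub] at this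

/-- The factor n is the price for passing from the sup norm of the coordinates, in which cubes are
balls, to the Hilbert–Schmidt norm. -/
theorem norm_skewPart_le (A : Mat n) : ‖skewPart A‖ ≤ n * ‖skewCoord A‖ :=
  norm_le_of_abs_apply_le (norm_nonneg _) (abs_skewPart_apply_le A)

theorem skewPart_eq_of_skewCoord_eq {A B : Mat n} (h : skewCoord A = skewCoord B) :
    skewPart A = skewPart B := by
  have h1 := norm_skewPart_le (A - B)
  rw [map_sub, h, sub_self, norm_zero, mul_zero] at h1
  have h2 := norm_eq_zero.1 (le_antisymm h1 (norm_nonneg _))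
  rw [← sub_eq_zero, ← h2]
  simp only [skewPart, transpose_sub]
  module

/-- The derivative of a path of orthogonal matrices, moved to the identity, is skew-symmetric. -/
theorem skewPart_fderiv_mul_transpose {E : Type*} [NormedAddCommGroup E] [NormedSpace ℝ E]
    {f : E → Mat n} (hf : ∀ x, (f x)ᵀ * f x = 1) (hd : DifferentiableAt ℝ f 0) (h : E) :
    skewPart (fderiv ℝ f 0 h * (f 0)ᵀ) = fderiv ℝ f 0 h * (f 0)ᵀ := by
  have hA : HasDerivAt (fun t : ℝ => f (t • h)) (fderiv ℝ f 0 h) 0 := by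
    have h1 : HasDerivAt (fun t : ℝ => t • h) h 0 := by
      simpa using (hasDerivAt_id (0 : ℝ)).smul_const h
    have h2 : HasFDerivAt f (fderiv ℝ f 0) ((0 : ℝ) • h) := by
      rw [zero_smul]; exact hd.hasFDerivAt
    exact h2.comp_hasDerivAt 0 h1
  set A := fderiv ℝ f 0 h
  have hc : ∀ a c, HasDerivAt (fun t : ℝ => f (t • h) a c) (A a c) 0 := fun a c =>
    hasDerivAt_pi.1 (hasDerivAt_pi.1 hA a) c
  have hs : ∀ a b, (A * (f 0)ᵀ) b a = -(A * (f 0)ᵀ) a b := by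
    intro a b
    -- Differentiate the entries of f fᵀ = 1 along the line through h.
    have h1 := HasDerivAt.fun_sum fun c (_ : c ∈ Finset.univ) => (hc a c).mul (hc b c)
    have h2 : (fun t : ℝ => ∑ c, f (t • h) a c * f (t • h) b c) = fun _ => (1 : Mat n) a b := by
      ext t
      rw [← mul_transpose_of_orthogonal (hf (t • h))]
      simp [mul_apply]
    have h3 := h1.unique (h2 ▸ hasDerivAt_const (0 : ℝ) ((1 : Mat n) a b))
    simp only [zero_smul, Finset.sum_add_distrib] at h3
    simp only [mul_apply, transpose_apply]
    simp only [mul_comm (f 0 a _)] at h3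
    linarith
  ext a b
  simp only [skewPart, Matrix.smul_apply, Matrix.sub_apply, transpose_apply, hs a b, smul_eq_mul]
  ring

/-- A non-degenerate map from `ℝᴺ` to the orthogonal group gives linear coordinates of the
orthogonal group near its value at `0` in which its derivative is the identity. -/
theorem exists_chart {f : EuclideanSpace ℝ (Fin (numPlanes n)) → Mat n}
    (hf : ∀ x, (f x)ᵀ * f x = 1) (hd : DifferentiableAt ℝ f 0) {c : ℝ} (hc : 0 < c)
    (hfc : ∀ h, c * ‖h‖ ≤ ‖fderiv ℝ f 0 h‖) :
    ∃ Λ : Mat n →L[ℝ] (Fin (numPlanes n) → ℝ), (∀ A, ‖Λ A‖ ≤ n / c * ‖A‖) ∧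
      (∀ h : Fin (numPlanes n) → ℝ, Λ (fderiv ℝ f 0 (WithLp.toLp 2 h)) = h) ∧
      ∀ A B : Mat n, Aᵀ * A = 1 → Bᵀ * B = 1 → ‖A - f 0‖ ≤ 1 / 4 → ‖B - f 0‖ ≤ 1 / 4 →
        Λ A = Λ B → A = B := by
  have of := orthogonal_transpose (hf 0)
  let σ : Mat n →ₗ[ℝ] Plane n → ℝ := skewCoord ∘ₗ LinearMap.mulRight ℝ (f 0)ᵀ
  have hσ : ∀ A, σ A = skewCoord (A * (f 0)ᵀ) := fun A => rfl
  let L : (Fin (numPlanes n) → ℝ) →ₗ[ℝ] Plane n → ℝ :=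
    σ ∘ₗ (fderiv ℝ f 0).toLinearMap ∘ₗ
      (WithLp.linearEquiv 2 ℝ (Fin (numPlanes n) → ℝ)).symm.toLinearMap
  have hL : ∀ h, L h = σ (fderiv ℝ f 0 (WithLp.toLp 2 h)) := fun h => rfl
  have hLb : ∀ h, c * ‖h‖ ≤ n * ‖L h‖ := by
    intro h
    have h1 : ‖h‖ ≤ ‖WithLp.toLp 2 h‖ :=
      (pi_norm_le_iff_of_nonneg (norm_nonneg _)).2 fun k => PiLp.norm_apply_le (WithLp.toLp 2 h) k
    calc c * ‖h‖ ≤ c * ‖WithLp.toLp 2 h‖ := by gcongr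
      _ ≤ ‖fderiv ℝ f 0 (WithLp.toLp 2 h)‖ := hfc _
      _ = ‖skewPart (fderiv ℝ f 0 (WithLp.toLp 2 h) * (f 0)ᵀ)‖ := by
        rw [skewPart_fderiv_mul_transpose hf hd, norm_mul_orthogonal of]
      _ ≤ n * ‖L h‖ := norm_skewPart_le _
  have hinj : Function.Injective L := by
    refine (injective_iff_map_eq_zero L).2 fun h h0 => ?_
    have h1 := hLb h
    rw [h0, norm_zero, mul_zero] at h1
    exact norm_eq_zero.1 (le_antisymm (nonpos_of_mul_nonpos_right h1 hc) (norm_nonneg _))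
  -- There are as many perturbation coordinates as coordinate planes, so injectivity suffices.
  let Le := LinearEquiv.ofInjectiveOfFinrankEq L hinj (by simp [card_plane])
  have hLe : ∀ h, Le h = L h := fun h => rfl
  have hb : ∀ A, ‖Le.symm (σ A)‖ ≤ n / c * ‖A‖ := by
    intro A
    have h1 := hLb (Le.symm (σ A))
    rw [← hLe, LinearEquiv.apply_symm_apply] at h1
    have h2 : ‖σ A‖ ≤ ‖A‖ := (norm_skewCoord_le _).trans (norm_mul_orthogonal of A).le
    rw [div_mul_eq_mul_div, le_div_iff₀ hc, mul_comm]
    exact h1.trans (by gcongr)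
  refine ⟨LinearMap.mkContinuous (Le.symm.toLinearMap ∘ₗ σ) (n / c) hb, hb, fun h => ?_, ?_⟩
  · exact Le.symm_apply_apply h
  · intro A B hA hB hA1 hB1 hAB
    have h1 : skewCoord (A * (f 0)ᵀ) = skewCoord (B * (f 0)ᵀ) := Le.symm.injective hAB
    have h2 : ∀ A : Mat n, A * (f 0)ᵀ - 1 = (A - f 0) * (f 0)ᵀ := by
      intro A
      rw [Matrix.sub_mul, mul_transpose_of_orthogonal (hf 0)]
    have h3 := eq_of_skewPart_eq (orthogonal_mul hA of) (orthogonal_mul hB of)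
      (skewPart_eq_of_skewCoord_eq h1) (by rwa [h2, norm_mul_orthogonal of])
      (by rwa [h2, norm_mul_orthogonal of])
    have h4 := congrArg (· * f 0) h3
    simpa only [Matrix.mul_assoc, hf 0, Matrix.mul_one] using h4

end Chart

/-! ### Assembly and choice of parameters. -/

section CouplingConstruction

/-- Quantitative coupling of two perturbation maps whose unperturbed paths stay `w`-close. -/
theorem exists_coupling_inducedMap {n : ℕ} (hn : 2 ≤ n) {c w ε r : ℝ} {k : NNReal} {T : ℕ}
    {s : Fin (numPlanes n) → ℕ} {i : ℕ → Plane n} {X Y : Mat n}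
    (hX : Xᵀ * X = 1) (hY : Yᵀ * Y = 1) {η η' : ℕ → ℝ} (hc : 0 < c) (hr : 0 < r) (hrε : r < ε)
    (hw : ∀ t ≤ T, ‖path i η X t - path i η' Y t‖ ≤ w)
    (hf : ∀ h, c * ‖h‖ ≤ ‖fderiv ℝ (inducedMap X T s i η) 0 h‖)
    (hNε : 2 * numPlanes n * ε ≤ 1 / 14) (hw1 : w ≤ 1 / 14)
    (hMε : n / c * (4 * (numPlanes n : ℝ) ^ 2) * ε ≤ 1 / 2)
    (hwr : n / c * (2 * w) ≤ r / 4) (hk : k < 1)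
    (hwk : 2 * (n / c * (14 * numPlanes n * w) + n / c * (4 * (numPlanes n : ℝ) ^ 2) * r) ≤ k) :
    ∃ (Ω : Type) (_ : MeasurableSpace Ω) (P : Measure Ω) (_ : IsProbabilityMeasure P)
      (U V : Fin (numPlanes n) → Ω → ℝ),
      (∀ k, Measurable (U k)) ∧ (∀ k, Measurable (V k)) ∧
      iIndepFun U P ∧ iIndepFun V P ∧
      (∀ k, pdf.IsUniform (U k) (Set.Ioo (-ε) ε) P volume) ∧
      (∀ k, pdf.IsUniform (V k) (Set.Ioo (-ε) ε) P volume) ∧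
      P {z | inducedMap X T s i η (WithLp.toLp 2 fun k => U k z) ≠
          inducedMap Y T s i η' (WithLp.toLp 2 fun k => V k z)} ≤
        ENNReal.ofReal (numPlanes n * (k + r / ε)) := by
  have hε : 0 < ε := hr.trans hrε
  have hN : 0 < numPlanes n := by
    rw [← card_plane]
    exact Fintype.card_pos_iff.2 ⟨⟨(⟨0, by omega⟩, ⟨1, by omega⟩), by simp⟩⟩
  have hNr : (0 : ℝ) < numPlanes n := by exact_mod_cast hN
  have hw0 : 0 ≤ w := (norm_nonneg _).trans (hw T le_rfl)
  have hnc : 0 ≤ n / c := by positivity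
  set f := inducedMap X T s i η with hfdef
  set g := inducedMap Y T s i η' with hgdef
  have hfd : Differentiable ℝ f := differentiable_inducedMap X η
  have hgd : Differentiable ℝ g := differentiable_inducedMap Y η'
  have of := inducedMap_orthogonal (T := T) (s := s) (i := i) hX η
  have og := inducedMap_orthogonal (T := T) (s := s) (i := i) hY η'
  obtain ⟨Λ, hΛb, hΛd, hΛi⟩ := exists_chart of (hfd 0) hc hf
  have hε1 : 2 * numPlanes n * ε ≤ 1 := hNε.trans (by norm_num)
  have hfg0 : ‖g 0 - f 0‖ ≤ w := by
    rw [norm_sub_rev, hfdef, hgdef, inducedMap_zero, inducedMap_zero]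
    exact hw T le_rfl
  have hfg : ∀ y ∈ Metric.ball (0 : Fin (numPlanes n) → ℝ) ε,
      ‖g (WithLp.toLp 2 y) - f (WithLp.toLp 2 y)‖ ≤ 2 * w := by
    intro y hy
    rw [mem_ball_zero_iff] at hy
    have h1 := norm_inducedMap_diff_sub_le (s := s) hX hY η η' hw hε1 hy.le
      (y := 0) (by simpa using hε.le)
    rw [WithLp.toLp_zero, sub_zero] at h1
    have h2 : 14 * numPlanes n * w * ‖y‖ ≤ w := by
      have := mul_le_mul_of_nonneg_left hy.le (by positivity : 0 ≤ 14 * numPlanes n * w)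
      nlinarith
    have h3 := norm_sub_norm_le (g (WithLp.toLp 2 y) - f (WithLp.toLp 2 y)) (g 0 - f 0)
    linarith
  have hf4 : ∀ x ∈ Metric.ball (0 : Fin (numPlanes n) → ℝ) ε,
      ‖f (WithLp.toLp 2 x) - f 0‖ ≤ 1 / 14 := by
    intro x hx
    rw [mem_ball_zero_iff] at hx
    have h1 := norm_inducedMap_sub_le (T := T) (s := s) (i := i) hX η x 0
    rw [WithLp.toLp_zero, sub_zero] at h1
    exact h1.trans ((mul_le_mul_of_nonneg_left hx.le (by positivity)).trans hNε)
  have hg4 : ∀ y ∈ Metric.ball (0 : Fin (numPlanes n) → ℝ) ε,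
      ‖g (WithLp.toLp 2 y) - f 0‖ ≤ 1 / 4 := by
    intro y hy
    have h1 := norm_sub_le_norm_sub_add_norm_sub (g (WithLp.toLp 2 y)) (f (WithLp.toLp 2 y)) (f 0)
    linarith [hfg y hy, hf4 y hy]
  obtain ⟨e, he⟩ := exists_solution_near (F := fun x => Λ (f (WithLp.toLp 2 x)))
    (G := fun x => Λ (g (WithLp.toLp 2 x))) (M := n / c * (4 * (numPlanes n : ℝ) ^ 2))
    (l := n / c * (14 * numPlanes n * w)) (ε := ε) (r := r) (by positivity) hr
    (Λ.differentiable.comp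
      (hfd.comp (EuclideanSpace.equiv (Fin (numPlanes n)) ℝ).symm.differentiable))
    (by
      let ι := (EuclideanSpace.equiv (Fin (numPlanes n)) ℝ).symm.toContinuousLinearMap
      have h1 : HasFDerivAt f (fderiv ℝ f 0) (ι 0) := by
        rw [map_zero]; exact (hfd 0).hasFDerivAt
      have h2 : HasFDerivAt (fun x => Λ (f (WithLp.toLp 2 x))) (Λ ∘L (fderiv ℝ f 0 ∘L ι)) 0 :=
        Λ.hasFDerivAt.comp _ (h1.comp 0 ι.hasFDerivAt)
      rw [h2.fderiv]
      exact ContinuousLinearMap.ext hΛd)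
    (by
      intro x d e
      simp only [← map_sub, ← map_add]
      refine (hΛb _).trans ?_
      have h1 := mul_le_mul_of_nonneg_left (norm_inducedMap_second_difference_le (T := T) (s := s)
        (i := i) hX η x d e) hnc
      exact h1.trans (le_of_eq (by ring)))
    hMε
    (by
      intro y hy
      rw [← map_sub]
      exact (hΛb _).trans ((mul_le_mul_of_nonneg_left (hfg y hy) hnc).trans hwr))
    (by
      intro y hy z hz
      simp only [← map_sub]
      rw [mem_ball_zero_iff] at hy hz
      refine (hΛb _).trans ?_
      have h1 := mul_le_mul_of_nonneg_left (norm_inducedMap_diff_sub_le (s := s) hX hY η η' hw hε1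
        hy.le hz.le) hnc
      exact h1.trans (le_of_eq (by ring)))
  obtain ⟨P, hP1, hP2, hP⟩ := exists_uniform_coupling (k := k) hN hr hrε hk
    (fun y hy => (he y hy).1.trans (by linarith))
    (fun y hy z hz => ((he y hy).2.2 z hz).trans (mul_le_mul_of_nonneg_right hwk (norm_nonneg _)))
  have hv : volume (Set.Ioo (-ε) ε) ≠ 0 := by simp [hε]
  have := cond_isProbabilityMeasure_of_finite hv (by simp)
  have hPp : IsProbabilityMeasure P := ⟨by
    rw [← Set.preimage_univ (f := Prod.fst), ← Measure.map_apply measurable_fst .univ, hP1]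
    exact measure_univ⟩
  have hU : ∀ k, pdf.IsUniform (fun z : (Fin (numPlanes n) → ℝ) × (Fin (numPlanes n) → ℝ) => z.1 k)
      (Set.Ioo (-ε) ε) P volume := by
    intro k
    have h1 := (measurePreserving_eval (fun _ : Fin (numPlanes n) =>
      ProbabilityTheory.cond volume (Set.Ioo (-ε) ε)) k).map_eq
    rw [← hP1, Measure.map_map (measurable_pi_apply k) measurable_fst] at h1
    exact h1
  have hV : ∀ k, pdf.IsUniform (fun z : (Fin (numPlanes n) → ℝ) × (Fin (numPlanes n) → ℝ) => z.2 k)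
      (Set.Ioo (-ε) ε) P volume := by
    intro k
    have h1 := (measurePreserving_eval (fun _ : Fin (numPlanes n) =>
      ProbabilityTheory.cond volume (Set.Ioo (-ε) ε)) k).map_eq
    rw [← hP2, Measure.map_map (measurable_pi_apply k) measurable_snd] at h1
    exact h1
  refine ⟨(Fin (numPlanes n) → ℝ) × (Fin (numPlanes n) → ℝ), inferInstance, P, hPp,
    fun k z => z.1 k, fun k z => z.2 k, fun k => by fun_prop, fun k => by fun_prop, ?_, ?_, hU, hV,
    ?_⟩
  · refine (iIndepFun_iff_map_fun_eq_pi_map fun k => by fun_prop).2 ?_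
    refine hP1.trans ?_
    congr 1
    exact funext fun k => (hU k).symm
  · refine (iIndepFun_iff_map_fun_eq_pi_map fun k => by fun_prop).2 ?_
    refine hP2.trans ?_
    congr 1
    exact funext fun k => (hV k).symm
  · refine hP _ ?_ fun y hy => ?_
    · have hfc := hfd.continuous
      have hgc := hgd.continuous
      exact (isClosed_eq (by fun_prop) (by fun_prop)).isOpen_compl.measurableSet
    · obtain ⟨h1, h2, -⟩ := he y hy
      rw [mem_ball_zero_iff] at hy
      have hy1 : y ∈ Metric.ball (0 : Fin (numPlanes n) → ℝ) ε := by
        rw [mem_ball_zero_iff]; linarith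
      have hy2 : y + e y ∈ Metric.ball (0 : Fin (numPlanes n) → ℝ) ε := by
        rw [mem_ball_zero_iff]; linarith [norm_add_le y (e y)]
      simp only [Set.mem_ofPred_eq, not_not]
      exact hΛi _ _ (of _) (og _) ((hf4 _ hy2).trans (by norm_num)) (hg4 _ hy1) h2

/-- The coupling for parameters that are separated by powers of a small number `ϕ`. -/
theorem exists_coupling_scaffold {n : ℕ} (hn : 2 ≤ n) {ϕ w : ℝ} (hϕ : 0 < ϕ)
    (hϕn : (2 * (n : ℝ)) ^ 30 * ϕ ≤ 1) (hw : 0 < w) (hwϕ : w ≤ ϕ ^ 899) {σ : ℝ}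
    (hσ : σ = 1 ∨ σ = -1) {T : ℕ} {s : Fin (numPlanes n) → ℕ} {i : ℕ → Plane n} {η : ℕ → ℝ}
    {X Y : Mat n} (hX : Xᵀ * X = 1) (hY : Yᵀ * Y = 1) (h0 : σ = -1 → ‖X - Y‖ ≤ w)
    (hT : ‖path i η X T - scaffold σ i η X Y T‖ ≤ w)
    (hf : ∀ h, ϕ / 2 * ‖h‖ ≤ ‖fderiv ℝ (inducedMap X T s i η) 0 h‖) :
    ∃ (Ω : Type) (_ : MeasurableSpace Ω) (P : Measure Ω) (_ : IsProbabilityMeasure P)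
      (U V : Fin (numPlanes n) → Ω → ℝ),
      (∀ k, Measurable (U k)) ∧ (∀ k, Measurable (V k)) ∧
      iIndepFun U P ∧ iIndepFun V P ∧
      (∀ k, pdf.IsUniform (U k) (Set.Ioo (-ϕ ^ 30) (ϕ ^ 30)) P volume) ∧
      (∀ k, pdf.IsUniform (V k) (Set.Ioo (-ϕ ^ 30) (ϕ ^ 30)) P volume) ∧
      P {z | inducedMap X T s i η (WithLp.toLp 2 fun k => U k z) ≠
          inducedMap Y T s i (scaffoldAngle σ i η X Y) (WithLp.toLp 2 fun k => V k z)} ≤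
        ENNReal.ofReal (513 * (numPlanes n : ℝ) ^ 2 * ϕ⁻¹ * ϕ ^ 30) := by
  have hn2 : (2 : ℝ) ≤ n := by exact_mod_cast hn
  have hNn : (numPlanes n : ℝ) ≤ (n : ℝ) ^ 2 := by
    have h : numPlanes n ≤ n ^ 2 := by
      rw [numPlanes, sq]
      exact (Nat.div_le_self _ _).trans (Nat.mul_le_mul_left _ (Nat.sub_le _ _))
    exact_mod_cast h
  have hN1 : (1 : ℝ) ≤ numPlanes n := by
    have : 0 < numPlanes n := by
      rw [← card_plane]
      exact Fintype.card_pos_iff.2 ⟨⟨(⟨0, by omega⟩, ⟨1, by omega⟩), by simp⟩⟩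
    exact_mod_cast this
  have hpow : ∀ j ≤ 29, (n : ℝ) ^ j * ϕ ≤ 1 / 2 ^ 30 := by
    intro j hj
    have h1 : (n : ℝ) ^ j ≤ (n : ℝ) ^ 30 := pow_le_pow_right₀ (by linarith) (by omega)
    have h2 := mul_le_mul_of_nonneg_right h1 hϕ.le
    rw [mul_pow, mul_assoc] at hϕn
    rw [le_div_iff₀ (by positivity)]
    linarith
  have hϕs : ϕ ≤ 1 / 2 ^ 30 := by simpa using hpow 0 (by norm_num)
  have hϕ1 : ϕ ≤ 1 := hϕs.trans (by norm_num)
  have hnϕ : n * ϕ ≤ 1 := by simpa using (hpow 1 (by norm_num)).trans (by norm_num)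
  have hNϕ : numPlanes n * ϕ ≤ 1 := by
    have := mul_le_mul_of_nonneg_right hNn hϕ.le
    linarith [(hpow 2 (by norm_num)).trans (by norm_num : (1 : ℝ) / 2 ^ 30 ≤ 1)]
  have hle : ∀ {a b : ℕ}, a ≤ b → ϕ ^ b ≤ ϕ ^ a := fun h =>
    pow_le_pow_of_le_one hϕ.le hϕ1 h
  -- the two radii in terms of `ϕ`
  set r : ℝ := 16 * ϕ ^ 897 with hrdef
  set k : NNReal := ⟨ϕ ^ 40, by positivity⟩
  have hkr : (k : ℝ) = ϕ ^ 40 := rfl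
  have hw' : ∀ t ≤ T, ‖path i η X t - path i (scaffoldAngle σ i η X Y) Y t‖ ≤ w := by
    intro t ht
    rw [path_scaffoldAngle]
    exact norm_sub_scaffold_le hσ i η hX hY h0 hT ht
  have hnc : n / (ϕ / 2) ≤ 2 / ϕ ^ 2 := by
    rw [div_le_div_iff₀ (by positivity) (by positivity)]
    nlinarith
  have hN2 : (numPlanes n : ℝ) ≤ 1 / ϕ := by rwa [le_div_iff₀ hϕ]
  have hN22 : (numPlanes n : ℝ) ^ 2 ≤ 1 / ϕ ^ 2 := by
    have := pow_le_pow_left₀ (by linarith) hN2 2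
    rwa [div_pow, one_pow] at this
  have hM : n / (ϕ / 2) * (4 * (numPlanes n : ℝ) ^ 2) ≤ 8 / ϕ ^ 4 := by
    calc n / (ϕ / 2) * (4 * (numPlanes n : ℝ) ^ 2) ≤ 2 / ϕ ^ 2 * (4 * (1 / ϕ ^ 2)) := by gcongr
      _ = 8 / ϕ ^ 4 := by field_simp; norm_num
  -- The chart has norm at most 2/ϕ², so it turns 2 w ≤ 2 ϕ^899 into at most 4 ϕ^897 = r/4. The
  -- Lipschitz constant of e is then at most 56 ϕ^896 + 256 ϕ^893, far below k = ϕ^40.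
  obtain ⟨Ω, mΩ, P, hP, U, V, hU, hV, iU, iV, uU, uV, hUV⟩ :=
    exists_coupling_inducedMap hn (s := s) (c := ϕ / 2) (w := w) (ε := ϕ ^ 30) (r := r) (k := k)
      hX hY (by positivity) (by positivity)
      (by
        calc r = 16 * ϕ * ϕ ^ 896 := by rw [hrdef]; ring
          _ ≤ 16 * ϕ * ϕ ^ 30 := by gcongr 16 * ϕ * ?_; exact hle (by norm_num)
          _ < 1 * ϕ ^ 30 := by gcongr; linarith
          _ = _ := one_mul _)
      hw' hf
      (by
        calc 2 * numPlanes n * ϕ ^ 30 = 2 * (numPlanes n * ϕ) * ϕ ^ 29 := by ring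
          _ ≤ 2 * 1 * ϕ ^ 1 := by gcongr 2 * ?_ * ?_; exact hle (by norm_num)
          _ ≤ _ := by linarith)
      (hwϕ.trans ((hle (by norm_num : 1 ≤ 899)).trans (by linarith)))
      (by
        calc _ ≤ 8 / ϕ ^ 4 * ϕ ^ 30 := by gcongr
          _ = 8 * ϕ ^ 26 := by field_simp
          _ ≤ 8 * ϕ ^ 1 := by gcongr 8 * ?_; exact hle (by norm_num)
          _ ≤ _ := by linarith)
      (by
        calc _ ≤ 2 / ϕ ^ 2 * (2 * ϕ ^ 899) := by gcongr
          _ = 4 * ϕ ^ 897 := by field_simp; norm_num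
          _ = r / 4 := by rw [hrdef]; ring
          _ ≤ _ := le_rfl)
      (by
        rw [← NNReal.coe_lt_coe, hkr, NNReal.coe_one]
        exact (hle (by norm_num : 1 ≤ 40)).trans_lt (by linarith))
      (by
        calc _ ≤ 2 * (2 / ϕ ^ 2 * (14 * (1 / ϕ) * ϕ ^ 899) + 8 / ϕ ^ 4 * r) := by gcongr
          _ = 56 * ϕ * ϕ ^ 895 + 256 * ϕ * ϕ ^ 892 := by rw [hrdef]; field_simp; ring
          _ ≤ 56 * ϕ * ϕ ^ 40 + 256 * ϕ * ϕ ^ 40 := by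
            gcongr 56 * ϕ * ?_ + 256 * ϕ * ?_ <;> exact hle (by norm_num)
          _ = 312 * ϕ * ϕ ^ 40 := by ring
          _ ≤ 1 * ϕ ^ 40 := by gcongr; linarith
          _ = k := by rw [hkr, one_mul])
  refine ⟨Ω, mΩ, P, hP, U, V, hU, hV, iU, iV, uU, uV, hUV.trans (ENNReal.ofReal_le_ofReal ?_)⟩
  calc (numPlanes n : ℝ) * (k + r / ϕ ^ 30)
      = numPlanes n * (ϕ ^ 40 + 16 * ϕ ^ 867) := by rw [hkr, hrdef]; field_simp
    _ ≤ numPlanes n ^ 2 * (ϕ ^ 29 + 16 * ϕ ^ 29) := by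
        have h1 : (numPlanes n : ℝ) ≤ numPlanes n ^ 2 := by nlinarith
        have h2 : ϕ ^ 40 ≤ ϕ ^ 29 := hle (by norm_num)
        have h3 : ϕ ^ 867 ≤ ϕ ^ 29 := hle (by norm_num)
        exact mul_le_mul h1 (by linarith) (by positivity) (by positivity)
    _ ≤ 513 * (numPlanes n : ℝ) ^ 2 * ϕ ^ 29 := by
        nlinarith [mul_nonneg (sq_nonneg (numPlanes n : ℝ)) (pow_nonneg hϕ.le 29)]
    _ = _ := by field_simp

/-- The threshold on the final distance is a large power of `φ`. -/
theorem distance_threshold_le {n : ℕ} (hn : 2 ≤ n) {ϕ C : ℝ} (hϕ : 0 < ϕ)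
    (hϕn : (2 * (n : ℝ)) ^ 30 * ϕ ≤ 1)
    (hC : C < Real.log ((ϕ ^ 30) ^ 30) / Real.log (ϕ ^ 30) - 6) :
    (ϕ ^ 30) ^ 30 * (n : ℝ) ^ (5 + C) ≤ ϕ ^ 899 := by
  have hn2 : (2 : ℝ) ≤ n := by exact_mod_cast hn
  have hϕn' : (n : ℝ) ^ 30 * ϕ ≤ 1 := by
    refine le_trans ?_ hϕn
    gcongr
    linarith
  have hϕ1 : ϕ < 1 := by
    have h1 : (1 : ℝ) < (2 * (n : ℝ)) ^ 30 := one_lt_pow₀ (by linarith) (by norm_num)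
    nlinarith
  have hlog : Real.log (ϕ ^ 30) ≠ 0 := by
    rw [Real.log_pow]
    exact mul_ne_zero (by norm_num) (Real.log_neg hϕ hϕ1).ne
  -- The quotient of logarithms is exactly 30, so C < 24 and 5 + C < 30; one factor ϕ absorbs the
  -- power of n.
  rw [Real.log_pow (n := 30) (x := ϕ ^ 30), mul_div_cancel_right₀ _ hlog] at hC
  have h1 : (n : ℝ) ^ (5 + C) ≤ (n : ℝ) ^ (30 : ℕ) := by
    rw [← Real.rpow_natCast]
    refine Real.rpow_le_rpow_of_exponent_le (by linarith) ?_
    push_cast at hC ⊢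
    linarith
  calc (ϕ ^ 30) ^ 30 * (n : ℝ) ^ (5 + C) ≤ (ϕ ^ 30) ^ 30 * (n : ℝ) ^ 30 := by gcongr
    _ = ϕ ^ 899 * ((n : ℝ) ^ 30 * ϕ) := by ring
    _ ≤ ϕ ^ 899 * 1 := by gcongr
    _ = _ := mul_one _

/-- With N ≤ n² and n⁵ φ ≤ 1 the bound is at most 513/n. -/
theorem tendsto_failure_bound {φ : ℕ → ℝ}
    (hφ : ∀ n : ℕ, 2 ≤ n → 0 < φ n ∧ (2 * (n : ℝ)) ^ 30 * φ n ≤ 1) :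
    Tendsto (fun n : ℕ => 513 * (numPlanes n : ℝ) ^ 2 * (φ n)⁻¹ * φ n ^ 30) atTop (𝓝 0) := by
  have hlim : Tendsto (fun n : ℕ => 513 * (n : ℝ)⁻¹) atTop (𝓝 0) := by
    simpa using (tendsto_inv_atTop_nhds_zero_nat (𝕜 := ℝ)).const_mul 513
  refine tendsto_of_tendsto_of_tendsto_of_le_of_le' tendsto_const_nhds hlim ?_ ?_
  · filter_upwards [eventually_ge_atTop 2] with n hn
    have := (hφ n hn).1
    positivity
  · filter_upwards [eventually_ge_atTop 2] with n hn
    obtain ⟨h0, h1⟩ := hφ n hn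
    have hn2 : (2 : ℝ) ≤ n := by exact_mod_cast hn
    have hNn : (numPlanes n : ℝ) ≤ (n : ℝ) ^ 2 := by
      have h : numPlanes n ≤ n ^ 2 := by
        rw [numPlanes, sq]
        exact (Nat.div_le_self _ _).trans (Nat.mul_le_mul_left _ (Nat.sub_le _ _))
      exact_mod_cast h
    have h5 : (n : ℝ) ^ 5 * φ n ≤ 1 := by
      refine le_trans ?_ h1
      gcongr
      calc (n : ℝ) ^ 5 ≤ (n : ℝ) ^ 30 := pow_le_pow_right₀ (by linarith) (by norm_num)
        _ ≤ _ := by gcongr; linarith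
    have hφ1 : φ n ≤ 1 := by
      have : (1 : ℝ) ≤ (n : ℝ) ^ 5 := one_le_pow₀ (by linarith)
      nlinarith
    calc 513 * (numPlanes n : ℝ) ^ 2 * (φ n)⁻¹ * φ n ^ 30
        = 513 * (numPlanes n : ℝ) ^ 2 * φ n ^ 29 := by field_simp
      _ ≤ 513 * ((n : ℝ) ^ 2) ^ 2 * φ n ^ 1 := by
          gcongr 513 * ?_ ^ 2 * ?_
          exact pow_le_pow_of_le_one h0.le hφ1 (by norm_num)
      _ = 513 * ((n : ℝ) ^ 5 * φ n) * (n : ℝ)⁻¹ := by field_simp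
      _ ≤ 513 * 1 * (n : ℝ)⁻¹ := by gcongr
      _ = _ := by rw [mul_one]

end CouplingConstruction

end KacWalk

theorem mainTheorem9 (φ ε ω : ℕ → ℝ) (C : ℝ)
    (hφ : ∀ n : ℕ, 2 ≤ n → 0 < φ n ∧ φ n ≤ (2 * (n : ℝ)) ^ (-30 : ℤ))
    (hε : ∀ n, ε n = φ n ^ 30) (hω : ∀ n, ω n = ε n ^ 30)
    (hC : 0 < C) (hC' : ∀ n : ℕ, 2 ≤ n → C < Real.log (ω n) / Real.log (ε n) - 6) :
    (∀ (n : ℕ), 2 ≤ n →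
      ∀ (σ : ℝ), (σ = 1 ∨ σ = -1) →
      ∀ (T : ℕ) (s : Fin (KacWalk.numPlanes n) → ℕ), StrictMono s → (∀ l, s l < T) →
      ∀ (i : ℕ → KacWalk.Plane n) (η : ℕ → ℝ)
        (X₀ Y₀ : Matrix.specialOrthogonalGroup (Fin n) ℝ),
      (σ = -1 → ‖(X₀ : KacWalk.Mat n) - (Y₀ : KacWalk.Mat n)‖ ≤ ω n) →
      ∀ (f g : EuclideanSpace ℝ (Fin (KacWalk.numPlanes n)) → KacWalk.Mat n),
      f = KacWalk.inducedMap X₀ T s i η →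
      g = KacWalk.inducedMap Y₀ T s i (KacWalk.scaffoldAngle σ i η X₀ Y₀) →
      ‖f 0 - g 0‖ ≤ ω n * (n : ℝ) ^ (5 + C) →
      (∀ q, q = f ∨ q = g → ∀ h : EuclideanSpace ℝ (Fin (KacWalk.numPlanes n)), h ≠ 0 →
        φ n ≤ 2 * ‖fderiv ℝ q 0 h‖ / ‖h‖ ∧
        ‖fderiv ℝ q 0 h‖ / ‖h‖ ≤ (KacWalk.numPlanes n : ℝ)) →
      ∃ (Ω : Type) (_ : MeasurableSpace Ω) (P : Measure Ω) (_ : IsProbabilityMeasure P)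
        (U V : Fin (KacWalk.numPlanes n) → Ω → ℝ),
        (∀ k, Measurable (U k)) ∧ (∀ k, Measurable (V k)) ∧
        iIndepFun U P ∧ iIndepFun V P ∧
        (∀ k, pdf.IsUniform (U k) (Set.Ioo (-ε n) (ε n)) P volume) ∧
        (∀ k, pdf.IsUniform (V k) (Set.Ioo (-ε n) (ε n)) P volume) ∧
        P {z | f (WithLp.toLp 2 fun k => U k z) ≠ g (WithLp.toLp 2 fun k => V k z)} ≤
          ENNReal.ofReal (513 * (KacWalk.numPlanes n : ℝ) ^ 2 * (φ n)⁻¹ * ε n)) ∧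
    Tendsto (fun n : ℕ => 513 * (KacWalk.numPlanes n : ℝ) ^ 2 * (φ n)⁻¹ * ε n) atTop (𝓝 0) := by
  have hφ' : ∀ n : ℕ, 2 ≤ n → 0 < φ n ∧ (2 * (n : ℝ)) ^ 30 * φ n ≤ 1 := by
    intro n hn
    obtain ⟨h0, h1⟩ := hφ n hn
    have hn2 : (2 : ℝ) ≤ n := by exact_mod_cast hn
    refine ⟨h0, ?_⟩
    have h2 : (0 : ℝ) < (2 * (n : ℝ)) ^ 30 := by positivity
    rw [← mul_inv_cancel₀ h2.ne']
    rw [zpow_neg] at h1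
    exact mul_le_mul_of_nonneg_left h1 h2.le
  refine ⟨?_, ?_⟩
  · intro n hn σ hσ T s _ _ i η X₀ Y₀ h0 f g hf hg hfg hq
    obtain ⟨hϕ, hϕn⟩ := hφ' n hn
    have hω' : ω n = (φ n ^ 30) ^ 30 := by rw [hω, hε]
    have hC2 := hC' n hn
    rw [hω', hε] at hC2
    have hX := (Matrix.mem_orthogonalGroup_iff' (Fin n) ℝ).1
      (Matrix.mem_specialOrthogonalGroup_iff.1 X₀.2).1
    have hY := (Matrix.mem_orthogonalGroup_iff' (Fin n) ℝ).1
      (Matrix.mem_specialOrthogonalGroup_iff.1 Y₀.2).1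
    have hn1 : (1 : ℝ) ≤ n := by exact_mod_cast (by omega : 1 ≤ n)
    -- Positivity of C makes the larger threshold at time T serve also for the distance at time 0.
    have hωn : ω n ≤ ω n * (n : ℝ) ^ (5 + C) := by
      refine le_mul_of_one_le_right (by rw [hω']; positivity) ?_
      exact Real.one_le_rpow hn1 (by linarith)
    have hder : ∀ h, φ n / 2 * ‖h‖ ≤ ‖fderiv ℝ f 0 h‖ := by
      intro h
      rcases eq_or_ne h 0 with rfl | hh
      · simp
      · have h1 := (hq f (Or.inl rfl) h hh).1
        rw [le_div_iff₀ (norm_pos_iff.2 hh)] at h1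
        linarith
    subst hf hg
    rw [KacWalk.inducedMap_zero, KacWalk.inducedMap_zero, KacWalk.path_scaffoldAngle] at hfg
    rw [hε]
    refine KacWalk.exists_coupling_scaffold hn hϕ hϕn (w := ω n * (n : ℝ) ^ (5 + C)) ?_ ?_ hσ
      hX hY (fun h => (h0 h).trans hωn) hfg hder
    · rw [hω']; positivity
    · rw [hω']; exact KacWalk.distance_threshold_le hn hϕ hϕn hC2
  · simp only [hε]
    exact KacWalk.tendsto_failure_bound hφ'
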